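/- All graphs are undirected and connected, without loops and multiple edges. A graph $H$ covers a graph $G$ if there is a homomorphism $\alpha$ from $H$ onto $G$ (a covering map) that restricts to a bijection from $N(v)$ onto $N(\alpha(v))$ for each vertex $v$ of $H$. A universal cover of $G$ is a connected, possibly infinite, graph that covers every connected covering graph of $G$ (it is a tree, unique up to isomorphism). For a rooted tree $T_v$ and $i\ge 0$, let $T^i_v$ be the subgraph induced on the vertices at distance at most $i$ from the root $v$, with the same root; $\cong$ denotes isomorphism of rooted trees. For a vertex $x$ of $G$, let $U_x(G)$ be the universal cover of $G$ obtained by unfolding $G$ from $x$: its vertices are the non-backtracking walks in $G$ starting at $x$, two of them being adjacent if one extends the other by one vertex, and its root is the walk of length $0$; let $U^t_x(G)$ be its truncation at depth $t$. Let $T(n)$ be the minimum $t$ such that, for all connected graphs $G$ and $H$ with at most $n$ vertices each and all vertices $x$ of $G$ and $y$ of $H$, $U^t_x(G)\cong U^t_y(H)$ implies $U_x(G)\cong U_y(H)$. **Theorem.** (1) For every $n\ge 3$ there are connected $n$-vertex graphs $G$ and $H$ such that any universal covers $U$ of $G$ and $W$ of $H$ contain vertices $x$ of $U$ and $y$ of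 $W$ for which $U^i_x\cong W^i_y$ for all integers $0\le i\le 2n-16\sqrt n$, while $U_x\not\cong W_y$. (2) $T(n)$ exists for every $n$. It satisfies $T(n)<2n$ for all $n\ge 1$ and $T(n)>2n-16\sqrt n$ for all $n\ge 3$. Consequently $T(n)>n$ for some $n$, which answers in the negative Norris's question whether $T(n)\le n$ always holds, and $T(n)=(2-o(1))n$, that is, $T(n)/n\to 2$ as $n\to\infty$. -/

import Mathlib

open Filter Topology

universe u

/-! ### Covering maps and universal covers of simple graphs -/

/-- `α` is a covering map from `H` onto `G`: a homomorphism onto `G` that restricts, for every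
vertex `v` of `H`, to a bijection from the neighborhood of `v` onto the neighborhood of `α v`.
(The bijection condition contains the homomorphism condition; it is listed for readability.) -/
structure IsCoveringMapGraph {V W : Type*} (H : SimpleGraph W) (G : SimpleGraph V)
    (α : W → V) : Prop where
  map_adj : ∀ a b, H.Adj a b → G.Adj (α a) (α b)
  surjective : Function.Surjective α
  bijOn_neighborSet : ∀ v, Set.BijOn α (H.neighborSet v) (G.neighborSet (α v))

/-- `H` covers `G`. -/
def Covers {V W : Type*} (H : SimpleGraph W) (G : SimpleGraph V) : Prop :=
  ∃ α : W → V, IsCoveringMapGraph H G α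

/-- `U` is a universal cover of the connected graph `G`: a connected graph that covers every
connected covering graph of `G` (for connected `G`, this includes `G` itself). -/
def IsUniversalCover {VU V : Type u} (U : SimpleGraph VU) (G : SimpleGraph V) : Prop :=
  U.Connected ∧
    ∀ (X : Type u) (C : SimpleGraph X), C.Connected → Covers C G → Covers U C

/-! ### The unfolding of a graph from a vertex -/

/-- No entry of the list equals the entry two places further on. -/
def NoBacktrack {V : Type*} : List V → Prop
  | a :: b :: c :: l => a ≠ c ∧ NoBacktrack (b :: c :: l)
  | _ => True

/-- The non-backtracking walks in `G` that start at `x`. The walk `(x₀, x₁, …, x_k)`, with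
`x₀ = x`, is stored with its end first, as the list `[x_k, …, x₁, x₀]`. -/
def NBWalk {V : Type*} (G : SimpleGraph V) (x : V) : Type _ :=
  {l : List V // l.getLast? = some x ∧ l.IsChain G.Adj ∧ NoBacktrack l}

/-- The walk of length zero at `x`. -/
def NBWalk.root {V : Type*} (G : SimpleGraph V) (x : V) : NBWalk G x :=
  ⟨[x], by simp [NoBacktrack]⟩

/-- The unfolding `U_x(G)`: its vertices are the non-backtracking walks in `G` starting at `x`,
and two of them are adjacent if one of them extends the other by one vertex. -/
def unfolding {V : Type*} (G : SimpleGraph V) (x : V) : SimpleGraph (NBWalk G x) where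
  Adj p q := (∃ a, p.1 = a :: q.1) ∨ (∃ a, q.1 = a :: p.1)
  symm := ⟨fun _ _ h => h.symm⟩
  loopless := ⟨fun p h => by
    rcases h with ⟨a, h⟩ | ⟨a, h⟩ <;> exact absurd (congrArg List.length h) (by simp)⟩

/-! ### Rooted graphs, their truncations and isomorphisms -/

/-- The rooted graphs `(S, x)` and `(T, y)` are isomorphic. -/
def RootedIso {V W : Type*} (S : SimpleGraph V) (x : V) (T : SimpleGraph W) (y : W) : Prop :=
  ∃ e : S ≃g T, e x = y

/-- The vertices of `T` at distance at most `i` from `x`. -/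
def distBall {V : Type*} (T : SimpleGraph V) (x : V) (i : ℕ) : Set V :=
  {v | T.edist x v ≤ (i : ℕ∞)}

theorem mem_distBall_self {V : Type*} (T : SimpleGraph V) (x : V) (i : ℕ) :
    x ∈ distBall T x i := by
  simp [distBall]

/-- The truncations at depth `i` of `S` rooted at `x` and of `T` rooted at `y` (the subgraphs
induced on the vertices at distance at most `i` from the root) are isomorphic as rooted graphs. -/
def TruncIso {V W : Type*} (i : ℕ) (S : SimpleGraph V) (x : V) (T : SimpleGraph W) (y : W) :
    Prop :=
  RootedIso (S.induce (distBall S x i)) ⟨x, mem_distBall_self S x i⟩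
    (T.induce (distBall T y i)) ⟨y, mem_distBall_self T y i⟩

/-- Depth `t` suffices for graphs with at most `n` vertices: for all connected graphs `G`, `H`
with at most `n` vertices each, and all vertices `x` of `G` and `y` of `H`, isomorphism of
`U_x(G)` and `U_y(H)` truncated at depth `t` implies isomorphism of `U_x(G)` and `U_y(H)`. -/
def DepthSuffices (n t : ℕ) : Prop :=
  ∀ (V W : Type) [Finite V] [Finite W] (G : SimpleGraph V) (H : SimpleGraph W),
    G.Connected → H.Connected → Nat.card V ≤ n → Nat.card W ≤ n →
    ∀ (x : V) (y : W),
      TruncIso t (unfolding G x) (NBWalk.root G x) (unfolding H y) (NBWalk.root H y) →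
      RootedIso (unfolding G x) (NBWalk.root G x) (unfolding H y) (NBWalk.root H y)

/-! ### The unfolding of a connected graph is a universal cover of it -/

namespace NBWalk

variable {V : Type*} {G : SimpleGraph V} {x : V}

theorem ne_nil (p : NBWalk G x) : p.1 ≠ [] := by
  intro h
  have := p.2.1
  simp [h] at this

/-- The last vertex of a walk. -/
def endpoint (p : NBWalk G x) : V := p.1.head p.ne_nil

theorem noBacktrack_tail {a : V} {l : List V} (h : NoBacktrack (a :: l)) : NoBacktrack l := by
  match l, h with
  | [], _ => trivial
  | [_], _ => trivial
  | _ :: _ :: _, h => exact h.2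

theorem valid_tail {a b : V} {l : List V}
    (h : (a :: b :: l).getLast? = some x ∧ (a :: b :: l).IsChain G.Adj ∧
      NoBacktrack (a :: b :: l)) :
    (b :: l).getLast? = some x ∧ (b :: l).IsChain G.Adj ∧ NoBacktrack (b :: l) := by
  refine ⟨by simpa using h.1, ?_, noBacktrack_tail h.2.2⟩
  exact (List.isChain_cons_cons.1 h.2.1).2

theorem connected (G : SimpleGraph V) (x : V) : (unfolding G x).Connected := by
  have key : ∀ (l : List V) (h : l.getLast? = some x ∧ l.IsChain G.Adj ∧ NoBacktrack l),
      (unfolding G x).Reachable ⟨l, h⟩ (NBWalk.root G x) := by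
    intro l
    induction l with
    | nil => intro h; simp at h
    | cons a l ih =>
      intro h
      cases l with
      | nil =>
        have : a = x := by simpa using h.1
        subst this
        exact SimpleGraph.Reachable.refl _
      | cons b l =>
        refine SimpleGraph.Reachable.trans (SimpleGraph.Adj.reachable ?_) (ih (valid_tail h))
        exact Or.inl ⟨a, rfl⟩
  have : Nonempty (NBWalk G x) := ⟨NBWalk.root G x⟩
  exact ⟨fun p q => (key p.1 p.2).trans (key q.1 q.2).symm⟩

theorem adj_endpoint {p q : NBWalk G x} (h : (unfolding G x).Adj p q) :
    G.Adj p.endpoint q.endpoint := by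
  have key : ∀ {p q : NBWalk G x} {a : V}, p.1 = a :: q.1 → G.Adj p.endpoint q.endpoint := by
    rintro ⟨l, hl⟩ ⟨m, hm⟩ a h
    simp only at h
    subst h
    cases m with
    | nil => simp at hm
    | cons b m => exact (List.isChain_cons_cons.1 hl.2.1).1
  rcases h with ⟨a, h⟩ | ⟨a, h⟩
  · exact key h
  · exact (key h).symm

theorem endpoint_bijOn (p : NBWalk G x) :
    Set.BijOn endpoint ((unfolding G x).neighborSet p) (G.neighborSet p.endpoint) := by
  refine ⟨fun q hq => adj_endpoint hq, ?_, ?_⟩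
  · have mixed : ∀ {q r : NBWalk G x} {a b : V}, p.1 = a :: q.1 → r.1 = b :: p.1 →
        q.endpoint ≠ r.endpoint := by
      rintro ⟨m, hm⟩ ⟨n, hn⟩ a b h₁ h₂ h
      obtain ⟨l, hl⟩ := p
      simp only at h₁ h₂
      subst h₁
      subst h₂
      cases m with
      | nil => simp at hm
      | cons c m => exact hn.2.2.1 h.symm
    intro q hq r hr h
    rcases hq with ⟨a, hq⟩ | ⟨a, hq⟩ <;> rcases hr with ⟨b, hr⟩ | ⟨b, hr⟩
    · exact Subtype.ext (List.cons.inj (hq.symm.trans hr)).2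
    · exact absurd h (mixed hq hr)
    · exact absurd h.symm (mixed hr hq)
    · apply Subtype.ext
      obtain ⟨l, hl⟩ := q
      obtain ⟨m, hm⟩ := r
      simp only at hq hr
      subst hq
      subst hr
      have : a = b := h
      subst this
      rfl
  · intro c hc
    obtain ⟨l, hl⟩ := p
    have ext : ∀ {a : V} {m : List V} (hm : (a :: m).getLast? = some x ∧
        (a :: m).IsChain G.Adj ∧ NoBacktrack (a :: m)), G.Adj a c → NoBacktrack (c :: a :: m) →
        ∃ q, (unfolding G x).Adj ⟨a :: m, hm⟩ q ∧ q.endpoint = c := by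
      intro a m hm hac hnb
      refine ⟨⟨c :: a :: m, by simpa using hm.1, ?_, hnb⟩, Or.inr ⟨c, rfl⟩, rfl⟩
      exact List.isChain_cons_cons.2 ⟨hac.symm, hm.2.1⟩
    match l, hl, hc with
    | [], hl, _ => simp at hl
    | [a], hl, hc => exact ext hl hc trivial
    | a :: b :: m, hl, hc =>
      by_cases hcb : c = b
      · exact ⟨⟨b :: m, valid_tail hl⟩, Or.inl ⟨a, rfl⟩, hcb.symm⟩
      · exact ext hl hc ⟨hcb, hl.2.2⟩

end NBWalk

/-- The lift, along `α`, of a walk that starts at `α y` to one that starts at `y`; the value is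
the last vertex of the lift. -/
noncomputable def liftEnd {V X : Type*} (C : SimpleGraph X) (α : X → V) (y : X) : List V → X
  | [] => y
  | [_] => y
  | a :: b :: l =>
      haveI : Nonempty X := ⟨y⟩
      Function.invFunOn α (C.neighborSet (liftEnd C α y (b :: l))) a

/-- A homomorphism to a connected graph that is surjective on neighborhoods is surjective. -/
theorem surjective_of_surjOn_neighborSet {W X : Type*} {U : SimpleGraph W} {C : SimpleGraph X}
    (hC : C.Connected) (w : W) (β : W → X)
    (h : ∀ v, Set.SurjOn β (U.neighborSet v) (C.neighborSet (β v))) :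
    Function.Surjective β := by
  intro c
  obtain ⟨p⟩ := hC.preconnected (β w) c
  have key : ∀ {b c : X} (_ : C.Walk b c), (∃ v, β v = b) → ∃ v, β v = c := by
    intro b c p
    induction p with
    | nil => exact id
    | cons hadj _ ih =>
      rintro ⟨v, rfl⟩
      obtain ⟨v', -, hv'⟩ := h v hadj
      exact ih ⟨v', hv'⟩
  exact key p ⟨w, rfl⟩

/-- The unfolding of a graph from any vertex is a universal cover of it. -/
theorem unfolding_isUniversalCover {V : Type u} (G : SimpleGraph V) (x : V) :
    IsUniversalCover (unfolding G x) G := by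
  refine ⟨NBWalk.connected G x, ?_⟩
  rintro X C hC ⟨α, hα⟩
  obtain ⟨y, rfl⟩ := hα.surjective x
  have : Nonempty X := ⟨y⟩
  have step : ∀ (z : X) (a : V), G.Adj (α z) a →
      C.Adj z (Function.invFunOn α (C.neighborSet z) a) ∧
        α (Function.invFunOn α (C.neighborSet z) a) = a := by
    intro z a ha
    have hex : ∃ b ∈ C.neighborSet z, α b = a := (hα.bijOn_neighborSet z).surjOn ha
    exact ⟨Function.invFunOn_mem hex, Function.invFunOn_eq hex⟩
  have lift_eq : ∀ (l : List V) (h : l.getLast? = some (α y) ∧ l.IsChain G.Adj ∧ NoBacktrack l),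
      α (liftEnd C α y l) = NBWalk.endpoint (G := G) (x := α y) ⟨l, h⟩ := by
    intro l
    induction l with
    | nil => intro h; simp at h
    | cons a l ih =>
      intro h
      cases l with
      | nil =>
        have : a = α y := by simpa using h.1
        exact this.symm
      | cons b l =>
        have hb := ih (NBWalk.valid_tail h)
        have hab : G.Adj (α (liftEnd C α y (b :: l))) a := by
          rw [hb]
          exact (List.isChain_cons_cons.1 h.2.1).1.symm
        exact (step _ _ hab).2
  have hom : ∀ p q : NBWalk G (α y), (∃ a, p.1 = a :: q.1) →
      C.Adj (liftEnd C α y p.1) (liftEnd C α y q.1) := by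
    rintro ⟨l, hl⟩ ⟨m, hm⟩ ⟨a, h⟩
    simp only at h
    subst h
    cases m with
    | nil => simp at hm
    | cons b m =>
      have hab : G.Adj (α (liftEnd C α y (b :: m))) a := by
        rw [lift_eq _ hm]
        exact (List.isChain_cons_cons.1 hl.2.1).1.symm
      exact (step _ _ hab).1.symm
  let β : NBWalk G (α y) → X := fun p => liftEnd C α y p.1
  have hβ : ∀ p q, (unfolding G (α y)).Adj p q → C.Adj (β p) (β q) := by
    rintro p q (h | h)
    · exact hom p q h
    · exact (hom q p h).symm
  have hαβ : ∀ p, α (β p) = p.endpoint := fun p => lift_eq p.1 p.2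
  have hsurj : ∀ p, Set.SurjOn β ((unfolding G (α y)).neighborSet p) (C.neighborSet (β p)) := by
    intro p c hc
    have hc' : α c ∈ G.neighborSet p.endpoint := by
      rw [← hαβ p]
      exact hα.map_adj _ _ hc
    obtain ⟨q, hq, hqc⟩ := (NBWalk.endpoint_bijOn p).surjOn hc'
    exact ⟨q, hq, (hα.bijOn_neighborSet (β p)).injOn (hβ p q hq) hc ((hαβ q).trans hqc)⟩
  refine ⟨β, hβ, surjective_of_surjOn_neighborSet hC (NBWalk.root G (α y)) β hsurj, fun p => ?_⟩
  refine ⟨fun q hq => hβ p q hq, fun q hq r hr h => ?_, hsurj p⟩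
  exact (NBWalk.endpoint_bijOn p).injOn hq hr (by rw [← hαβ, ← hαβ, h])

/-! Everything is translated into color refinement: the unfoldings from `x` and `y`, truncated at
depth `t`, are isomorphic exactly when `t` rounds do not separate `x` from `y`. From left to right,
`Bisim.of_truncIso` compares the roots of the unfoldings and `bisim_of_bisim_unfolding` projects to
the graphs. From right to left, `truncIso_unfolding_of_bisim` translates walks vertex by vertex
through matchings of neighborhoods; each matching is first adjusted to respect the vertex just left,
so that non-backtracking walks go to non-backtracking walks.

Upper bound: on the disjoint union of the two graphs, with at most `2 * n` vertices, every round
before stabilization creates a new class, so `2 * n - 1` rounds decide everything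
(`Bisim.of_card_le`).

Lower bound: two lollipops are compared. Each is a row of long paths joined by 4-cycles, with an
origin marked by leaves and a loop at the far end; the loop contains one long path in the first
graph and two in the second. Away from the origin the two graphs look alike everywhere, up to
reversal of paths. To notice a difference from the origin, one must go down to the depth `m` where
the graphs begin to differ and come back to the origin, so the origins agree for `2 * m` rounds
(`bisim_two_mul_of_homogeneous`, `lollipop.bisim_origin`). They are separated eventually because the
largest distance from the leaves differs (`lollipop.not_forall_bisim`). A path with `L` vertices and
its two connectors give `L + 1` levels of depth, a loss of one vertex per path; the loop and the
leaves cost `O(L)`. With `L` about `√n` this gives `m ≥ n - 8√n`.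

Arbitrary universal covers reduce to unfoldings, because a connected cover of an unfolding is
bijective. -/

/-! ### Bisimilarity up to a given depth -/

/-- The vertices `u` of `G` and `v` of `H` are bisimilar up to depth `t`: color refinement does
not distinguish them in `t` rounds. -/
def Bisim {V W : Type*} (G : SimpleGraph V) (H : SimpleGraph W) : ℕ → V → W → Prop
  | 0, _, _ => True
  | t + 1, u, v => ∃ e : G.neighborSet u ≃ H.neighborSet v, ∀ a : G.neighborSet u, Bisim G H t a (e a)

/-- Passing to a neighbor increases the distance from the root by at most one. -/
theorem edist_add_le_of_adj {Z : Type*} {S : SimpleGraph Z} {z p q : Z} {s t : ℕ}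
    (hp : S.edist z p + (s + 1 : ℕ) ≤ t) (hpq : S.Adj p q) : S.edist z q + s ≤ t := by
  refine le_trans ?_ hp
  have h1 : S.edist z q ≤ S.edist z p + S.edist p q := S.edist_triangle
  rw [SimpleGraph.edist_eq_one_iff_adj.2 hpq] at h1
  calc S.edist z q + s ≤ S.edist z p + 1 + s := by gcongr
    _ = S.edist z p + (s + 1 : ℕ) := by push_cast; ring

theorem mem_distBall_of_edist_add_le {Z : Type*} {S : SimpleGraph Z} {z q : Z} {s t : ℕ}
    (hq : S.edist z q + s ≤ t) : q ∈ distBall S z t :=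
  le_trans le_self_add hq

namespace Bisim

variable {V W X : Type*} {G : SimpleGraph V} {H : SimpleGraph W} {K : SimpleGraph X}

theorem refl (G : SimpleGraph V) (t : ℕ) (u : V) : Bisim G G t u u := by
  induction t generalizing u with
  | zero => trivial
  | succ t ih => exact ⟨Equiv.refl _, fun a => ih a⟩

theorem symm {t : ℕ} {u : V} {v : W} (h : Bisim G H t u v) : Bisim H G t v u := by
  induction t generalizing u v with
  | zero => trivial
  | succ t ih =>
    obtain ⟨e, he⟩ := h
    refine ⟨e.symm, fun a => ih ?_⟩
    simpa using he (e.symm a)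

theorem trans {t : ℕ} {u : V} {v : W} {w : X} (h : Bisim G H t u v) (h' : Bisim H K t v w) :
    Bisim G K t u w := by
  induction t generalizing u v w with
  | zero => trivial
  | succ t ih =>
    obtain ⟨e, he⟩ := h
    obtain ⟨f, hf⟩ := h'
    exact ⟨e.trans f, fun a => ih (he a) (hf (e a))⟩

theorem of_succ {t : ℕ} {u : V} {v : W} (h : Bisim G H (t + 1) u v) : Bisim G H t u v := by
  induction t generalizing u v with
  | zero => trivial
  | succ t ih =>
    obtain ⟨e, he⟩ := h
    exact ⟨e, fun a => ih (he a)⟩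

theorem mono {s t : ℕ} (hst : s ≤ t) {u : V} {v : W} (h : Bisim G H t u v) :
    Bisim G H s u v := by
  induction t, hst using Nat.le_induction with
  | base => exact h
  | succ t _ ih => exact ih h.of_succ

/-- A map that is bijective on neighborhoods preserves bisimilarity types. -/
theorem of_bijOn {α : V → W} (h : ∀ v, Set.BijOn α (G.neighborSet v) (H.neighborSet (α v)))
    (t : ℕ) (v : V) : Bisim G H t v (α v) := by
  induction t generalizing v with
  | zero => trivial
  | succ t ih => exact ⟨(h v).equiv, fun a => ih a⟩

theorem of_iso (e : G ≃g H) (t : ℕ) (v : V) : Bisim G H t v (e v) := by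
  refine of_bijOn (fun v => ⟨fun a ha => ?_, e.injective.injOn, fun b hb => ?_⟩) t v
  · exact e.map_adj_iff.2 ha
  · refine ⟨e.symm b, ?_, by simp⟩
    rw [SimpleGraph.mem_neighborSet, ← e.map_adj_iff]
    simpa using hb

theorem of_rootedIso {x : V} {y : W} (h : RootedIso G x H y) (t : ℕ) : Bisim G H t x y := by
  obtain ⟨e, rfl⟩ := h
  exact of_iso e t x

/-- As long as distance from the root plus rounds left is at most `t` on both sides, all neighbors
lie inside the balls, so the isomorphism of truncations restricts to a bijection between full
neighborhoods. -/
theorem of_truncIso {t : ℕ} {x : V} {y : W} (h : TruncIso t G x H y) : Bisim G H t x y := by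
  obtain ⟨e, he⟩ := h
  have key : ∀ (s : ℕ) (p : distBall G x t), G.edist x p + s ≤ t → H.edist y (e p) + s ≤ t →
      Bisim G H s p (e p) := by
    intro s
    induction s with
    | zero => intro p _ _; trivial
    | succ s ih =>
      intro p hp hq
      have hG : ∀ a : G.neighborSet p, (a : V) ∈ distBall G x t := fun a =>
        mem_distBall_of_edist_add_le (edist_add_le_of_adj hp a.2)
      have hH : ∀ b : H.neighborSet (e p), (b : W) ∈ distBall H y t := fun b =>
        mem_distBall_of_edist_add_le (edist_add_le_of_adj hq b.2)
      have hf : ∀ a : G.neighborSet p, H.Adj (e p) (e ⟨a, hG a⟩) := fun a => by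
        have : (G.induce (distBall G x t)).Adj p ⟨a, hG a⟩ := a.2
        exact e.map_adj_iff.2 this
      have hg : ∀ b : H.neighborSet (e p), G.Adj p (e.symm ⟨b, hH b⟩) := fun b => by
        have : (H.induce (distBall H y t)).Adj (e p) ⟨b, hH b⟩ := b.2
        have h2 := e.symm.map_adj_iff.2 this
        rwa [e.symm_apply_apply] at h2
      refine ⟨⟨fun a => ⟨e ⟨a, hG a⟩, hf a⟩, fun b => ⟨e.symm ⟨b, hH b⟩, hg b⟩, fun a => ?_,
        fun b => ?_⟩, fun a => ?_⟩
      · apply Subtype.ext; simp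
      · apply Subtype.ext; simp
      · exact ih ⟨a, hG a⟩ (edist_add_le_of_adj hp a.2) (edist_add_le_of_adj hq (hf a))
  have := key t ⟨x, mem_distBall_self G x t⟩ (by simp) (by rw [he]; simp)
  rwa [he] at this

/-- Vertices of equal color after `t` rounds lead to equally colored matchings of their
neighborhoods that contain a prescribed pair. -/
theorem exists_equiv_extending {P : V → W → Prop}
    (zigzag : ∀ a b c d, P a b → P c b → P c d → P a d) {u : V} {v : W}
    (e : G.neighborSet u ≃ H.neighborSet v) (he : ∀ a : G.neighborSet u, P a (e a)) (c : G.neighborSet u)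
    (d : H.neighborSet v) (hcd : P c d) :
    ∃ f : G.neighborSet u ≃ H.neighborSet v, (∀ a : G.neighborSet u, P a (f a)) ∧ f c = d := by
  classical
  -- Besides `c`, only the vertex formerly sent to `d` changes its image; it now goes to `e c`, and
  -- `zigzag` through `d` and `c` keeps it related.
  refine ⟨e.trans (Equiv.swap (e c) d), fun a => ?_, by simp⟩
  rcases eq_or_ne a c with rfl | hac
  · simpa using hcd
  · rcases eq_or_ne (e a) d with had | had
    · have h1 : P a d := had ▸ he a
      have : ((e.trans (Equiv.swap (e c) d)) a : H.neighborSet v) = e c := by simp [had]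
      rw [this]
      exact zigzag _ _ _ _ h1 hcd (he c)
    · have : (e.trans (Equiv.swap (e c) d)) a = e a := by
        simp only [Equiv.trans_apply]
        exact Equiv.swap_apply_of_ne_of_ne (fun h => hac (e.injective h)) had
      rw [this]
      exact he a

end Bisim

/-! ### From bisimilarity to isomorphism of unfoldings -/

/-- The list `l` stores a non-backtracking walk in `G` that starts at `x`. -/
def IsNBWalk {V : Type*} (G : SimpleGraph V) (x : V) (l : List V) : Prop :=
  l.getLast? = some x ∧ l.IsChain G.Adj ∧ NoBacktrack l

/-- The vertices by which the non-backtracking walk `l` can be extended. -/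
def nbExtensions {V : Type*} (G : SimpleGraph V) (x : V) (l : List V) : Set V :=
  {a | IsNBWalk G x (a :: l)}

/-- Two walks of equal length whose corresponding prefixes end in related vertices, where the
relation may depend on the length of the prefix. -/
inductive WalkRel {V W : Type*} (P : ℕ → V → W → Prop) : List V → List W → Prop
  | nil : WalkRel P [] []
  | cons {a : V} {b : W} {l : List V} {m : List W} :
      WalkRel P l m → P (l.length + 1) a b → WalkRel P (a :: l) (b :: m)

theorem WalkRel.length_eq {V W : Type*} {P : ℕ → V → W → Prop} {l : List V} {m : List W}
    (h : WalkRel P l m) : l.length = m.length := by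
  induction h with
  | nil => rfl
  | cons _ _ ih => simp [ih]

/-- Translation of walks of one graph to walks of another one, where `Φ l m` translates the
vertices that extend `l` when the translation of `l` is `m`. -/
def mapWalk {V W : Type*} (y : W) (Φ : List V → List W → V → W) : List V → List W
  | [] => []
  | [_] => [y]
  | a :: b :: l => Φ (b :: l) (mapWalk y Φ (b :: l)) a :: mapWalk y Φ (b :: l)

section

variable {V W : Type*} {G : SimpleGraph V} {H : SimpleGraph W} {x : V} {y : W}

theorem IsNBWalk.ne_nil {l : List V} (h : IsNBWalk G x l) : l ≠ [] := by
  rintro rfl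
  simp [IsNBWalk] at h

theorem isNBWalk_singleton {a : V} : IsNBWalk G x [a] ↔ a = x := by
  simp [IsNBWalk, NoBacktrack]

theorem IsNBWalk.tail {a b : V} {l : List V} (h : IsNBWalk G x (a :: b :: l)) :
    IsNBWalk G x (b :: l) :=
  NBWalk.valid_tail h

theorem mem_nbExtensions_singleton {a u : V} (h : IsNBWalk G x [u]) :
    a ∈ nbExtensions G x [u] ↔ G.Adj u a := by
  have := h.1
  simp [nbExtensions, IsNBWalk, NoBacktrack, G.adj_comm] at this ⊢
  simp [this]

theorem mem_nbExtensions_cons {a u c : V} {l : List V} (h : IsNBWalk G x (u :: c :: l)) :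
    a ∈ nbExtensions G x (u :: c :: l) ↔ G.Adj u a ∧ a ≠ c := by
  obtain ⟨h1, h2, h3⟩ := h
  simp only [nbExtensions, Set.mem_ofPred_eq, IsNBWalk, List.isChain_cons_cons, NoBacktrack,
    List.getLast?_cons_cons, G.adj_comm] at h1 h2 h3 ⊢
  tauto

variable {P : ℕ → V → W → Prop} {I : ℕ → Prop}

/-- The extensions of a walk are the neighbors of its end except the vertex just left, so the
matching must send that vertex to its counterpart. These two were related at a length smaller by two
than the one needed, whence the double use of `mono`; `Bisim.exists_equiv_extending` then adjusts
the matching. -/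
theorem exists_bijOn_nbExtensions
    (zigzag : ∀ k a b c d, P k a b → P k c b → P k c d → P k a d)
    (mono : ∀ k a b, P k a b → P (k + 1) a b)
    (step : ∀ k u v, I (k + 1) → P k u v →
      ∃ e : G.neighborSet u ≃ H.neighborSet v, ∀ a : G.neighborSet u, P (k + 1) a (e a))
    {l : List V} {m : List W} (hl : IsNBWalk G x l) (hm : IsNBWalk H y m) (hlm : WalkRel P l m)
    (hI : I (l.length + 1)) :
    ∃ φ : V → W, Set.BijOn φ (nbExtensions G x l) (nbExtensions H y m) ∧
      ∀ a ∈ nbExtensions G x l, P (l.length + 1) a (φ a) := by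
  classical
  cases hlm with
  | nil => exact absurd rfl hl.ne_nil
  | @cons u v l m hlm huv =>
    obtain ⟨e, he⟩ := step _ _ _ hI huv
    let ext (f : G.neighborSet u ≃ H.neighborSet v) : V → W := fun a =>
      if h : a ∈ G.neighborSet u then f ⟨a, h⟩ else v
    have hext : ∀ (f : G.neighborSet u ≃ H.neighborSet v) (a : V) (h : G.Adj u a),
        ext f a = f ⟨a, h⟩ := fun f a h => dif_pos h
    have hinj : ∀ f, Set.InjOn (ext f) (G.neighborSet u) := by
      intro f a ha b hb hab
      rw [hext f a ha, hext f b hb] at hab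
      exact congrArg Subtype.val (f.injective (Subtype.ext hab))
    cases hlm with
    | nil =>
      refine ⟨ext e, ⟨fun a ha => ?_, fun a ha b hb => ?_, fun b hb => ?_⟩, fun a ha => ?_⟩
      · rw [mem_nbExtensions_singleton hl] at ha
        rw [mem_nbExtensions_singleton hm, hext e a ha]
        exact (e ⟨a, ha⟩).2
      · rw [mem_nbExtensions_singleton hl] at ha hb
        exact hinj e ha hb
      · rw [mem_nbExtensions_singleton hm] at hb
        refine ⟨e.symm ⟨b, hb⟩, ?_, ?_⟩
        · rw [mem_nbExtensions_singleton hl]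
          exact (e.symm ⟨b, hb⟩).2
        · rw [hext e _ (e.symm ⟨b, hb⟩).2]
          simp
      · rw [mem_nbExtensions_singleton hl] at ha
        rw [hext e a ha]
        exact he ⟨a, ha⟩
    | @cons c d l m hlm hcd =>
      have huc : G.Adj u c := (List.isChain_cons_cons.1 hl.2.1).1
      have hvd : H.Adj v d := (List.isChain_cons_cons.1 hm.2.1).1
      obtain ⟨f, hf, hfc⟩ := Bisim.exists_equiv_extending (zigzag _) e he ⟨c, huc⟩ ⟨d, hvd⟩
        (mono _ _ _ (mono _ _ _ hcd))
      have hfc' : ext f c = d := by rw [hext f c huc, hfc]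
      refine ⟨ext f, ⟨fun a ha => ?_, fun a ha b hb => ?_, fun b hb => ?_⟩, fun a ha => ?_⟩
      · rw [mem_nbExtensions_cons hl] at ha
        rw [mem_nbExtensions_cons hm]
        refine ⟨?_, fun h => ha.2 (hinj f ha.1 huc (h.trans hfc'.symm))⟩
        rw [hext f a ha.1]
        exact (f ⟨a, ha.1⟩).2
      · rw [mem_nbExtensions_cons hl] at ha hb
        exact hinj f ha.1 hb.1
      · rw [mem_nbExtensions_cons hm] at hb
        have hb' : ext f (f.symm ⟨b, hb.1⟩) = b := by
          rw [hext f _ (f.symm ⟨b, hb.1⟩).2]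
          simp
        refine ⟨f.symm ⟨b, hb.1⟩, ?_, hb'⟩
        rw [mem_nbExtensions_cons hl]
        refine ⟨(f.symm ⟨b, hb.1⟩).2, fun h => hb.2 ?_⟩
        rw [← hb', h, hfc']
      · rw [mem_nbExtensions_cons hl] at ha
        rw [hext f a ha.1]
        exact hf ⟨a, ha.1⟩

/-- A family of relations that propagates along walks induces a bijection between the
non-backtracking walks of admissible lengths that respects extension of walks. -/
theorem exists_bijOn_isNBWalk
    (zigzag : ∀ k a b c d, P k a b → P k c b → P k c d → P k a d)
    (mono : ∀ k a b, P k a b → P (k + 1) a b)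
    (hI : ∀ k, I (k + 1) → I k)
    (step : ∀ k u v, I (k + 1) → P k u v →
      ∃ e : G.neighborSet u ≃ H.neighborSet v, ∀ a : G.neighborSet u, P (k + 1) a (e a))
    (hxy : P 1 x y) :
    ∃ F : List V → List W,
      Set.BijOn F {l | IsNBWalk G x l ∧ I l.length} {m | IsNBWalk H y m ∧ I m.length} ∧
      F [x] = [y] ∧ (∀ a b l, (F (a :: b :: l)).tail = F (b :: l)) ∧
      ∀ l, (F l).length = l.length := by
  classical
  -- The hypotheses stand inside the existential, so that `Φ` can be chosen for all pairs of lists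
  -- before the translation of walks is defined from it.
  have key : ∀ (l : List V) (m : List W), ∃ φ : V → W,
      IsNBWalk G x l → IsNBWalk H y m → WalkRel P l m → I (l.length + 1) →
        Set.BijOn φ (nbExtensions G x l) (nbExtensions H y m) ∧
        ∀ a ∈ nbExtensions G x l, P (l.length + 1) a (φ a) := by
    intro l m
    by_cases h : IsNBWalk G x l ∧ IsNBWalk H y m ∧ WalkRel P l m ∧ I (l.length + 1)
    · obtain ⟨φ, hφ⟩ := exists_bijOn_nbExtensions zigzag mono step h.1 h.2.1 h.2.2.1 h.2.2.2
      exact ⟨φ, fun _ _ _ _ => hφ⟩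
    · exact ⟨fun _ => y, fun h1 h2 h3 h4 => absurd ⟨h1, h2, h3, h4⟩ h⟩
  choose Φ hΦ using key
  have hlen : ∀ l, (mapWalk y Φ l).length = l.length := by
    intro l
    induction l with
    | nil => rfl
    | cons a l ih =>
      cases l with
      | nil => rfl
      | cons b l => simpa [mapWalk] using ih
  have hmap : ∀ l, IsNBWalk G x l → I l.length →
      IsNBWalk H y (mapWalk y Φ l) ∧ WalkRel P l (mapWalk y Φ l) := by
    intro l
    induction l with
    | nil => intro h; exact absurd rfl h.ne_nil
    | cons a l ih =>
      intro h hk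
      cases l with
      | nil =>
        obtain rfl := isNBWalk_singleton.1 h
        exact ⟨isNBWalk_singleton.2 rfl, .cons .nil hxy⟩
      | cons b l =>
        obtain ⟨h1, h2⟩ := ih h.tail (hI _ hk)
        obtain ⟨h3, h4⟩ := hΦ _ _ h.tail h1 h2 hk
        exact ⟨h3.mapsTo h, .cons h2 (h4 a h)⟩
  refine ⟨mapWalk y Φ, ⟨fun l hl => ⟨(hmap l hl.1 hl.2).1, ?_⟩, fun l hl l' hl' h => ?_,
    fun m hm => ?_⟩, rfl, fun a b l => rfl, hlen⟩
  · rw [hlen]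
    exact hl.2
  · induction l generalizing l' with
    | nil => exact absurd rfl hl.1.ne_nil
    | cons a l ih =>
      have hll := congrArg List.length h
      rw [hlen, hlen] at hll
      cases l with
      | nil =>
        obtain ⟨a', rfl⟩ : ∃ a', l' = [a'] := List.length_eq_one_iff.1 (by simpa using hll.symm)
        rw [isNBWalk_singleton.1 hl.1, isNBWalk_singleton.1 hl'.1]
      | cons b l =>
        obtain ⟨a', b', l', rfl⟩ : ∃ a' b' l'', l' = a' :: b' :: l'' := by
          match l', hll with
          | a' :: b' :: l'', _ => exact ⟨a', b', l'', rfl⟩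
        simp only [mapWalk, List.cons.injEq] at h
        have := ih ⟨hl.1.tail, hI _ hl.2⟩ (b' :: l') ⟨hl'.1.tail, hI _ hl'.2⟩ h.2
        rw [this] at h hl ⊢
        obtain ⟨h1, h2⟩ := hmap (b' :: l') hl'.1.tail (hI _ hl'.2)
        rw [(hΦ _ _ hl'.1.tail h1 h2 hl'.2).1.injOn hl.1 hl'.1 h.1]
  · induction m with
    | nil => exact absurd rfl hm.1.ne_nil
    | cons b m ih =>
      cases m with
      | nil =>
        obtain rfl := isNBWalk_singleton.1 hm.1
        exact ⟨[x], ⟨isNBWalk_singleton.2 rfl, hm.2⟩, rfl⟩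
      | cons c m =>
        obtain ⟨l, hl, hlm⟩ := ih ⟨hm.1.tail, hI _ hm.2⟩
        obtain ⟨h1, h2⟩ := hmap l hl.1 hl.2
        have hk : l.length = (c :: m).length := by rw [← hlm, hlen]
        have hk' : I (l.length + 1) := by rw [hk]; exact hm.2
        have hm1 := hm.1
        rw [← hlm] at hm1
        obtain ⟨a, ha, hab⟩ := (hΦ _ _ hl.1 h1 h2 hk').1.surjOn hm1
        refine ⟨a :: l, ⟨ha, hk'⟩, ?_⟩
        obtain ⟨a', l', rfl⟩ := List.exists_cons_of_ne_nil hl.1.ne_nil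
        simp only [mapWalk]
        rw [hab, hlm]

/-- The shift by one arises because the root is a list of length one. -/
theorem edist_root_le_iff (p : NBWalk G x) (i : ℕ) :
    (unfolding G x).edist (NBWalk.root G x) p ≤ i ↔ p.1.length ≤ i + 1 := by
  have step : ∀ {p q : NBWalk G x}, (unfolding G x).Adj p q → q.1.length ≤ p.1.length + 1 := by
    rintro p q (⟨a, h⟩ | ⟨a, h⟩)
    · rw [h]; simp; omega
    · rw [h]; simp
  have walk : ∀ {p q : NBWalk G x} (w : (unfolding G x).Walk p q),
      q.1.length ≤ p.1.length + w.length := by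
    intro p q w
    induction w with
    | nil => simp
    | cons h w ih =>
      have := step h
      simp only [SimpleGraph.Walk.length_cons]
      omega
  have upper : ∀ (l : List V) (h : IsNBWalk G x l),
      (unfolding G x).edist (NBWalk.root G x) ⟨l, h⟩ + 1 ≤ l.length := by
    intro l
    induction l with
    | nil => intro h; exact absurd rfl h.ne_nil
    | cons a l ih =>
      intro h
      cases l with
      | nil =>
        have : (⟨[a], h⟩ : NBWalk G x) = NBWalk.root G x :=
          Subtype.ext (congrArg (fun z => [z]) (isNBWalk_singleton.1 h))
        rw [this]
        simp
      | cons b l =>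
        have hadj : (unfolding G x).Adj ⟨b :: l, h.tail⟩ ⟨a :: b :: l, h⟩ := Or.inr ⟨a, rfl⟩
        have h1 := (unfolding G x).edist_triangle (u := NBWalk.root G x) (v := ⟨b :: l, h.tail⟩)
          (w := ⟨a :: b :: l, h⟩)
        rw [SimpleGraph.edist_eq_one_iff_adj.2 hadj] at h1
        have h2 := ih h.tail
        rw [List.length_cons, Nat.cast_succ]
        gcongr
        exact h1.trans h2
  constructor
  · intro h
    have hne : (unfolding G x).edist (NBWalk.root G x) p ≠ ⊤ := fun h' => by simp [h'] at h
    obtain ⟨w, hw⟩ := (SimpleGraph.reachable_of_edist_ne_top hne).exists_walk_length_eq_edist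
    have h1 := walk w
    rw [← hw] at h
    have h2 : w.length ≤ i := by exact_mod_cast h
    have h3 : (NBWalk.root G x).1.length = 1 := rfl
    omega
  · intro h
    have h1 := upper p.1 p.2
    have h2 : ((p.1.length : ℕ) : ℕ∞) ≤ (i : ℕ∞) + 1 := by exact_mod_cast h
    exact (ENat.add_le_add_iff_right (by simp)).1 (h1.trans h2)

/-- A bijection between walks that respects extension of walks respects adjacency. -/
theorem adj_iff_of_bijOn {F : List V → List W} {A : Set (List V)} {B : Set (List W)}
    (hF : Set.BijOn F A B) (hA : ∀ a b l, a :: b :: l ∈ A → b :: l ∈ A)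
    (hlen : ∀ l, (F l).length = l.length)
    (htail : ∀ a b l, (F (a :: b :: l)).tail = F (b :: l)) {p q : List V} (hp : p ∈ A)
    (hq : q ∈ A) (hq0 : q ≠ []) : (∃ a, p = a :: q) ↔ ∃ b, F p = b :: F q := by
  obtain ⟨c, q, rfl⟩ := List.exists_cons_of_ne_nil hq0
  constructor
  · rintro ⟨a, rfl⟩
    have h1 := htail a c q
    have h2 := hlen (a :: c :: q)
    match h3 : F (a :: c :: q), h2 with
    | b :: m, _ =>
      rw [h3] at h1
      exact ⟨b, by rw [← h1]; rfl⟩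
  · rintro ⟨b, h⟩
    have h1 := congrArg List.length h
    rw [hlen, List.length_cons, hlen, List.length_cons] at h1
    match p, h1 with
    | a :: d :: p, _ =>
      have h2 := htail a d p
      rw [h, List.tail_cons] at h2
      have := hF.injOn hq (hA _ _ _ hp) h2
      exact ⟨a, by rw [this]⟩

theorem truncIso_unfolding_of_bisim {t : ℕ} (h : Bisim G H t x y) :
    TruncIso t (unfolding G x) (NBWalk.root G x) (unfolding H y) (NBWalk.root H y) := by
  -- A walk stored as a list of length `k` has used `k - 1` of the `t` rounds, so its end is
  -- compared with the remaining `t + 1 - k`.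
  obtain ⟨F, hF, hroot, htail, hlen⟩ := exists_bijOn_isNBWalk (G := G) (H := H) (x := x) (y := y)
    (P := fun k => Bisim G H (t + 1 - k)) (I := fun k => k ≤ t + 1)
    (fun k a b c d h1 h2 h3 => h1.trans (h2.symm.trans h3))
    (fun k a b h => h.mono (by omega)) (fun k h => by omega)
    (fun k u v hk h => by
      obtain ⟨s, hs⟩ : ∃ s, t + 1 - k = s + 1 := ⟨t - k, by omega⟩
      rw [hs] at h
      have : t + 1 - (k + 1) = s := by omega
      rw [this]
      exact h)
    (by simpa using h)
  let f : distBall (unfolding G x) (NBWalk.root G x) t →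
      distBall (unfolding H y) (NBWalk.root H y) t := fun p =>
    ⟨⟨F p.1.1, (hF.mapsTo ⟨p.1.2, (edist_root_le_iff _ _).1 p.2⟩).1⟩,
      (edist_root_le_iff _ _).2 (hF.mapsTo ⟨p.1.2, (edist_root_le_iff _ _).1 p.2⟩).2⟩
  have hf : Function.Bijective f := by
    constructor
    · intro p q hpq
      have h1 : F p.1.1 = F q.1.1 := congrArg (fun z => z.1.1) hpq
      exact Subtype.ext (Subtype.ext (hF.injOn ⟨p.1.2, (edist_root_le_iff _ _).1 p.2⟩
        ⟨q.1.2, (edist_root_le_iff _ _).1 q.2⟩ h1))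
    · intro q
      obtain ⟨l, hl, hlq⟩ := hF.surjOn ⟨q.1.2, (edist_root_le_iff _ _).1 q.2⟩
      exact ⟨⟨⟨l, hl.1⟩, (edist_root_le_iff _ _).2 hl.2⟩, Subtype.ext (Subtype.ext hlq)⟩
  have hadj := fun {p q : List V} => adj_iff_of_bijOn (p := p) (q := q) hF
    (fun a b l hl => ⟨hl.1.tail, Nat.le_of_succ_le hl.2⟩) hlen htail
  refine ⟨⟨Equiv.ofBijective f hf, fun {p q} => ?_⟩, Subtype.ext (Subtype.ext hroot)⟩
  have hp : p.1.1 ∈ {l | IsNBWalk G x l ∧ l.length ≤ t + 1} :=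
    ⟨p.1.2, (edist_root_le_iff _ _).1 p.2⟩
  have hq : q.1.1 ∈ {l | IsNBWalk G x l ∧ l.length ≤ t + 1} :=
    ⟨q.1.2, (edist_root_le_iff _ _).1 q.2⟩
  exact (or_congr (hadj hp hq q.1.ne_nil) (hadj hq hp p.1.ne_nil)).symm

theorem rootedIso_unfolding_of_relation {P : V → W → Prop}
    (zigzag : ∀ a b c d, P a b → P c b → P c d → P a d)
    (step : ∀ u v, P u v →
      ∃ e : G.neighborSet u ≃ H.neighborSet v, ∀ a : G.neighborSet u, P a (e a))
    (hxy : P x y) :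
    RootedIso (unfolding G x) (NBWalk.root G x) (unfolding H y) (NBWalk.root H y) := by
  obtain ⟨F, hF, hroot, htail, hlen⟩ := exists_bijOn_isNBWalk (G := G) (H := H) (x := x) (y := y)
    (P := fun _ => P) (I := fun _ => True) (fun _ => zigzag) (fun _ _ _ h => h) (fun _ h => h)
    (fun _ u v _ h => step u v h) hxy
  let f : NBWalk G x → NBWalk H y := fun p => ⟨F p.1, (hF.mapsTo ⟨p.2, trivial⟩).1⟩
  have hf : Function.Bijective f := by
    constructor
    · intro p q hpq
      have h1 : F p.1 = F q.1 := congrArg (fun z => z.1) hpq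
      exact Subtype.ext (hF.injOn ⟨p.2, trivial⟩ ⟨q.2, trivial⟩ h1)
    · intro q
      obtain ⟨l, hl, hlq⟩ := hF.surjOn ⟨q.2, trivial⟩
      exact ⟨⟨l, hl.1⟩, Subtype.ext hlq⟩
  have hadj := fun {p q : List V} => adj_iff_of_bijOn (p := p) (q := q) hF
    (fun a b l hl => ⟨hl.1.tail, trivial⟩) hlen htail
  refine ⟨⟨Equiv.ofBijective f hf, fun {p q} => ?_⟩, Subtype.ext hroot⟩
  exact (or_congr (hadj ⟨p.2, trivial⟩ ⟨q.2, trivial⟩ q.ne_nil)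
    (hadj ⟨q.2, trivial⟩ ⟨p.2, trivial⟩ p.ne_nil)).symm

end

/-! ### Stabilization of color refinement -/

section

variable {V W : Type*}

namespace Bisim

/-- Bisimilarity up to depth `t` as a setoid on the vertices of a graph. -/
def setoid (K : SimpleGraph V) (t : ℕ) : Setoid V where
  r := Bisim K K t
  iseqv := ⟨Bisim.refl K t, Bisim.symm, Bisim.trans⟩

theorem of_stable {K : SimpleGraph V} {t : ℕ}
    (h : ∀ u v, Bisim K K t u v → Bisim K K (t + 1) u v) (s : ℕ) {u v : V}
    (huv : Bisim K K t u v) : Bisim K K (t + s) u v := by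
  induction s generalizing u v with
  | zero => exact huv
  | succ s ih =>
    obtain ⟨e, he⟩ := h u v huv
    exact ⟨e, fun a => ih (he a)⟩

/-- Each unstable round strictly increases the number of classes, which is at least one initially
and never exceeds the number of vertices. -/
theorem exists_stable [Finite V] [Nonempty V] (K : SimpleGraph V) :
    ∃ t < Nat.card V, ∀ u v, Bisim K K t u v → Bisim K K (t + 1) u v := by
  by_contra! hcon
  have key : ∀ t ≤ Nat.card V, t < Nat.card (Quotient (setoid K t)) := by
    intro t
    induction t with
    | zero =>
      intro _
      have : Nonempty (Quotient (setoid K 0)) := Nonempty.map (Quotient.mk _) inferInstance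
      exact Nat.card_pos
    | succ t ih =>
      intro ht
      obtain ⟨u, v, huv, hne⟩ := hcon t (by omega)
      let f : Quotient (setoid K (t + 1)) → Quotient (setoid K t) :=
        Quotient.map id fun a b hab => Bisim.of_succ hab
      have hf : Function.Surjective f := by
        intro a
        induction a using Quotient.inductionOn with
        | h a => exact ⟨Quotient.mk _ a, rfl⟩
      have hlt : Nat.card (Quotient (setoid K t)) < Nat.card (Quotient (setoid K (t + 1))) := by
        refine lt_of_le_of_ne (Nat.card_le_card_of_surjective f hf) fun hcard => hne ?_
        have hb : Function.Bijective f := by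
          rw [Nat.bijective_iff_surjective_and_card]
          exact ⟨hf, hcard.symm⟩
        have : f (Quotient.mk _ u) = f (Quotient.mk _ v) := Quotient.sound huv
        exact Quotient.exact (hb.1 this)
      have := ih (by omega)
      omega
  have h1 := key _ le_rfl
  have h2 := Nat.card_le_card_of_surjective (Quotient.mk (setoid K (Nat.card V)))
    Quotient.mk_surjective
  omega

/-- In the disjoint union both vertices belong to one graph, whose refinement is stable after fewer
than `Nat.card V + Nat.card W` rounds. This is the source of the bound `2 * n - 1`. -/
theorem of_card_le [Finite V] [Finite W] {G : SimpleGraph V} {H : SimpleGraph W} {t : ℕ}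
    (ht : Nat.card V + Nat.card W ≤ t + 1) {u : V} {v : W} (h : Bisim G H t u v) (s : ℕ) :
    Bisim G H s u v := by
  have hl : ∀ a, Set.BijOn (Sum.inl : V → V ⊕ W) (G.neighborSet a)
      ((G ⊕g H).neighborSet (Sum.inl a)) := by
    refine fun a => ⟨fun b hb => by simpa using hb, Sum.inl_injective.injOn, fun b hb => ?_⟩
    cases b with
    | inl b => exact ⟨b, by simpa using hb, rfl⟩
    | inr b => simp at hb
  have hr : ∀ a, Set.BijOn (Sum.inr : W → V ⊕ W) (H.neighborSet a)
      ((G ⊕g H).neighborSet (Sum.inr a)) := by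
    refine fun a => ⟨fun b hb => by simpa using hb, Sum.inr_injective.injOn, fun b hb => ?_⟩
    cases b with
    | inr b => exact ⟨b, by simpa using hb, rfl⟩
    | inl b => simp at hb
  have : Nonempty (V ⊕ W) := ⟨Sum.inl u⟩
  obtain ⟨r, hr1, hr2⟩ := exists_stable (G ⊕g H)
  rw [Nat.card_sum] at hr1
  have h1 : Bisim (G ⊕g H) (G ⊕g H) t (Sum.inl u) (Sum.inr v) :=
    ((of_bijOn hl t u).symm.trans h).trans (of_bijOn hr t v)
  have h2 := of_stable hr2 s (h1.mono (by omega))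
  exact ((of_bijOn hl s u).trans (h2.mono (by omega))).trans (of_bijOn hr s v).symm

end Bisim

theorem bisim_unfolding {G : SimpleGraph V} {x : V} (t : ℕ) (p : NBWalk G x) :
    Bisim (unfolding G x) G t p p.endpoint :=
  Bisim.of_bijOn NBWalk.endpoint_bijOn t p

theorem bisim_of_bisim_unfolding {G : SimpleGraph V} {H : SimpleGraph W} {x : V} {y : W} {t : ℕ}
    (h : Bisim (unfolding G x) (unfolding H y) t (NBWalk.root G x) (NBWalk.root H y)) :
    Bisim G H t x y :=
  ((bisim_unfolding t (NBWalk.root G x)).symm.trans h).trans (bisim_unfolding t (NBWalk.root H y))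

theorem rootedIso_unfolding_of_bisim [Finite V] [Finite W] {G : SimpleGraph V}
    {H : SimpleGraph W} {x : V} {y : W} (h : ∀ t, Bisim G H t x y) :
    RootedIso (unfolding G x) (NBWalk.root G x) (unfolding H y) (NBWalk.root H y) := by
  refine rootedIso_unfolding_of_relation (P := fun u v => ∀ t, Bisim G H t u v)
    (fun a b c d h1 h2 h3 t => (h1 t).trans ((h2 t).symm.trans (h3 t))) (fun u v huv => ?_) h
  -- The matching could vary with the depth; one taken at a depth beyond stabilization serves all
  -- depths.
  obtain ⟨e, he⟩ := huv (Nat.card V + Nat.card W + 1)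
  exact ⟨e, fun a t => (he a).of_card_le (by omega) t⟩

theorem depthSuffices_two_mul_sub_one (n : ℕ) : DepthSuffices n (2 * n - 1) := by
  intro V W _ _ G H _ _ hV hW x y h
  refine rootedIso_unfolding_of_bisim fun t => ?_
  exact (bisim_of_bisim_unfolding (Bisim.of_truncIso h)).of_card_le (by omega) t

/-! ### Universal covers are unfoldings -/

/-- Dropping the last step of a walk lifts to a deterministic descent in `U` that ends over the
root. Adjacent vertices descend to the same end, so by connectedness only one vertex lies over the
root; injectivity follows by induction on the length of the walk. -/
theorem IsCoveringMapGraph.bijective_of_unfolding {X : Type*} {G : SimpleGraph V} {x : V}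
    {U : SimpleGraph X} (hU : U.Connected) {α : X → NBWalk G x}
    (hα : IsCoveringMapGraph U (unfolding G x) α) : Function.Bijective α := by
  classical
  refine ⟨?_, hα.surjective⟩
  have hpar : ∀ u : X, α u ≠ NBWalk.root G x →
      ∃ u', U.Adj u u' ∧ ∃ a, (α u).1 = a :: (α u').1 := by
    intro u hu
    obtain ⟨p, hp⟩ : ∃ p, α u = p := ⟨_, rfl⟩
    obtain ⟨l, hl⟩ := p
    match l, hl, hp with
    | [], hl, _ => simp at hl
    | [a], hl, hp =>
      exact absurd (hp.trans (Subtype.ext (congrArg (fun z => [z])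
        (isNBWalk_singleton.1 hl)))) hu
    | a :: b :: l, hl, hp =>
      have : (unfolding G x).Adj (α u) ⟨b :: l, NBWalk.valid_tail hl⟩ := by
        rw [hp]
        exact Or.inl ⟨a, rfl⟩
      obtain ⟨u', hu', hu'p⟩ := (hα.bijOn_neighborSet u).surjOn this
      exact ⟨u', hu', a, by rw [hp, hu'p]⟩
  have huniq : ∀ u v w : X, U.Adj u v → U.Adj u w → α v = α w → v = w := fun u v w hv hw h =>
    (hα.bijOn_neighborSet u).injOn hv hw h
  -- every vertex has a unique vertex over the root below it
  let R : X → X → Prop := fun u u' => U.Adj u u' ∧ ∃ a, (α u).1 = a :: (α u').1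
  have hRu : ∀ u v w, R u v → R u w → v = w := by
    rintro u v w ⟨hv, a, ha⟩ ⟨hw, b, hb⟩
    refine huniq u v w hv hw (Subtype.ext ?_)
    rw [ha] at hb
    exact (List.cons.inj hb).2
  have hroot : ∀ u v, R u v → α u ≠ NBWalk.root G x := by
    rintro u v ⟨-, a, ha⟩ h
    rw [h] at ha
    have : (α v).1 = [] := (List.cons.inj ha).2.symm
    exact (α v).ne_nil this
  have hex : ∀ (k : ℕ) (u : X), (α u).1.length = k →
      ∃ r, α r = NBWalk.root G x ∧ Relation.ReflTransGen R u r := by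
    intro k
    induction k with
    | zero => intro u hu; exact absurd (List.length_eq_zero_iff.1 hu) (α u).ne_nil
    | succ k ih =>
      intro u hu
      by_cases h : α u = NBWalk.root G x
      · exact ⟨u, h, .refl⟩
      · obtain ⟨u', h1, a, h2⟩ := hpar u h
        rw [h2] at hu
        obtain ⟨r, hr, hur⟩ := ih u' (by simpa using hu)
        exact ⟨r, hr, .head ⟨h1, a, h2⟩ hur⟩
  have hdet : ∀ u r v, Relation.ReflTransGen R u r → α r = NBWalk.root G x → R u v →
      Relation.ReflTransGen R v r := by
    intro u r v hur hr huv
    rcases hur.cases_head with rfl | ⟨w, hw, hwr⟩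
    · exact absurd hr (hroot _ _ huv)
    · rwa [hRu u v w huv hw]
  have hsame : ∀ u v r, U.Adj u v → α r = NBWalk.root G x → Relation.ReflTransGen R u r →
      Relation.ReflTransGen R v r := by
    intro u v r huv hr hur
    rcases hα.map_adj u v huv with ⟨a, h⟩ | ⟨a, h⟩
    · exact hdet u r v hur hr ⟨huv, a, h⟩
    · exact .head ⟨huv.symm, a, h⟩ hur
  have hall : ∀ u v r, α r = NBWalk.root G x → Relation.ReflTransGen R u r →
      Relation.ReflTransGen R v r := by
    intro u v r hr hur
    obtain ⟨w⟩ := hU.preconnected u v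
    induction w with
    | nil => exact hur
    | cons h _ ih => exact ih (hsame _ _ r h hr hur)
  obtain ⟨r, hr⟩ := hα.surjective (NBWalk.root G x)
  have hend : ∀ u, α u = NBWalk.root G x → u = r := by
    intro u hu
    rcases (hall r u r hr .refl).cases_head with h | ⟨w, hw, -⟩
    · exact h
    · exact absurd hu (hroot _ _ hw)
  have hinj : ∀ (k : ℕ) (u v : X), (α u).1.length = k → α u = α v → u = v := by
    intro k
    induction k with
    | zero => intro u v hu; exact absurd (List.length_eq_zero_iff.1 hu) (α u).ne_nil
    | succ k ih =>
      intro u v hu huv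
      by_cases h : α u = NBWalk.root G x
      · rw [hend u h, hend v (huv ▸ h)]
      · obtain ⟨u', h1, a, h2⟩ := hpar u h
        obtain ⟨v', h3, b, h4⟩ := hpar v (huv ▸ h)
        rw [huv, h4] at h2
        have h5 : α u' = α v' := Subtype.ext (List.cons.inj h2).2.symm
        have h6 : u' = v' := by
          refine ih u' v' ?_ h5
          rw [huv, h4] at hu
          rw [h5]
          simpa using hu
        subst h6
        exact huniq u' u v h1.symm h3.symm huv
  exact fun u v h => hinj _ u v rfl h

/-- The unfolding is itself a connected cover of `G`, so `U` covers it, and that covering map is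
bijective. -/
theorem IsUniversalCover.exists_iso_unfolding {X Y : Type u} {U : SimpleGraph X}
    {G : SimpleGraph Y} (hG : G.Connected) (hU : IsUniversalCover U G) (x : Y) :
    Nonempty (U ≃g unfolding G x) := by
  have hcov : Covers (unfolding G x) G :=
    ⟨NBWalk.endpoint, fun _ _ => NBWalk.adj_endpoint,
      surjective_of_surjOn_neighborSet hG (NBWalk.root G x) _
        fun p => (NBWalk.endpoint_bijOn p).surjOn, NBWalk.endpoint_bijOn⟩
  obtain ⟨α, hα⟩ := hU.2 _ _ (NBWalk.connected G x) hcov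
  have hb := hα.bijective_of_unfolding hU.1
  refine ⟨⟨Equiv.ofBijective α hb, fun {a b} => ⟨fun h => ?_, hα.map_adj a b⟩⟩⟩
  obtain ⟨c, hc, hcb⟩ := (hα.bijOn_neighborSet a).surjOn h
  rwa [← hb.1 hcb]

end

/-! ### Transport of truncations along isomorphisms -/

section

variable {V W X Y : Type*} {S : SimpleGraph V} {T : SimpleGraph W} {S' : SimpleGraph X}
  {T' : SimpleGraph Y} {x : V} {y : W} {x' : X} {y' : Y}

theorem RootedIso.symm (h : RootedIso S x T y) : RootedIso T y S x := by
  obtain ⟨e, rfl⟩ := h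
  exact ⟨e.symm, by simp⟩

theorem RootedIso.trans (h : RootedIso S x T y) (h' : RootedIso T y S' x') :
    RootedIso S x S' x' := by
  obtain ⟨e, rfl⟩ := h
  obtain ⟨f, rfl⟩ := h'
  exact ⟨f.comp e, rfl⟩

theorem edist_map_le (f : S →g T) (a b : V) : T.edist (f a) (f b) ≤ S.edist a b := by
  by_cases h : S.edist a b = ⊤
  · rw [h]; exact le_top
  · obtain ⟨w, hw⟩ := (SimpleGraph.reachable_of_edist_ne_top h).exists_walk_length_eq_edist
    rw [← hw, ← SimpleGraph.Walk.length_map f w]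
    exact SimpleGraph.edist_le _

theorem RootedIso.truncIso (h : RootedIso S x T y) (i : ℕ) : TruncIso i S x T y := by
  obtain ⟨e, rfl⟩ := h
  have key : ∀ v, v ∈ distBall S x i ↔ e v ∈ distBall T (e x) i := by
    intro v
    refine ⟨fun h => (edist_map_le e.toHom x v).trans h, fun h => ?_⟩
    have := (edist_map_le e.symm.toHom (e x) (e v)).trans h
    simpa [distBall] using this
  refine ⟨⟨e.toEquiv.subtypeEquiv key, ?_⟩, rfl⟩
  intro a b
  exact e.map_adj_iff

theorem TruncIso.trans {i : ℕ} (h : TruncIso i S x T y) (h' : TruncIso i T y S' x') :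
    TruncIso i S x S' x' :=
  RootedIso.trans h h'

end

/-- Two vertices that are bisimilar up to depth `t`, but not up to every depth, give rise to
vertices of arbitrary universal covers with isomorphic truncations. -/
theorem exists_truncIso_universalCover {V W : Type u} {G : SimpleGraph V} {H : SimpleGraph W}
    (hG : G.Connected) (hH : H.Connected) {g : V} {h : W}
    (hne : ¬ ∀ t, Bisim G H t g h) {VU VW : Type u} {U : SimpleGraph VU} {W' : SimpleGraph VW}
    (hU : IsUniversalCover U G) (hW : IsUniversalCover W' H) :
    ∃ (x : VU) (y : VW), (∀ i, Bisim G H i g h → TruncIso i U x W' y) ∧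
      ¬ RootedIso U x W' y := by
  obtain ⟨e⟩ := hU.exists_iso_unfolding hG g
  obtain ⟨f⟩ := hW.exists_iso_unfolding hH h
  have he : RootedIso U (e.symm (NBWalk.root G g)) (unfolding G g) (NBWalk.root G g) :=
    ⟨e, by simp⟩
  have hf : RootedIso W' (f.symm (NBWalk.root H h)) (unfolding H h) (NBWalk.root H h) :=
    ⟨f, by simp⟩
  refine ⟨e.symm (NBWalk.root G g), f.symm (NBWalk.root H h), fun i hi => ?_, fun hiso => ?_⟩
  · exact ((he.truncIso i).trans (truncIso_unfolding_of_bisim hi)).trans (hf.symm.truncIso i)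
  · have h1 := (he.symm.trans hiso).trans hf
    exact hne fun t => bisim_of_bisim_unfolding (Bisim.of_rootedIso h1 t)

/-! ### A lower bound criterion -/

section

variable {V W : Type*}

theorem Bisim.of_family {G : SimpleGraph V} {H : SimpleGraph W} {R : ℕ → V → W → Prop}
    (hR : ∀ t u v, R (t + 1) u v →
      ∃ e : G.neighborSet u ≃ H.neighborSet v, ∀ a : G.neighborSet u, R t a (e a))
    {t : ℕ} {u : V} {v : W} (h : R t u v) : Bisim G H t u v := by
  induction t generalizing u v with
  | zero => trivial
  | succ t ih =>
    obtain ⟨e, he⟩ := hR t u v h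
    exact ⟨e, fun a => ih (he a)⟩

/-- If two graphs agree at depth less than `m` and are homogeneous beyond depth `0`, then a
vertex of depth `0` is bisimilar to itself up to depth `2 * m`. -/
theorem bisim_two_mul_of_homogeneous {G H : SimpleGraph V} (m : ℕ) (d : V → ℕ)
    (ty : V → V → Prop) (hrefl : ∀ u, ty u u) (hdm : ∀ u, d u ≤ m)
    (hdG : ∀ u v, G.Adj u v → d v ≤ d u + 1) (hdH : ∀ u v, H.Adj u v → d v ≤ d u + 1)
    (hGH : ∀ u v, d u < m → (G.Adj u v ↔ H.Adj u v))
    (hty : ∀ u v, ty u v → 1 ≤ d u → 1 ≤ d v →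
      ∃ e : G.neighborSet u ≃ H.neighborSet v, ∀ a : G.neighborSet u, ty a (e a))
    {x : V} (hx : d x = 0) : Bisim G H (2 * m) x x := by
  -- With `t` rounds left, either both sides are still at the same vertex, having spent at least `d
  -- u` rounds, or they are at vertices of the same type too deep for depth `0` to matter. The
  -- change of regime occurs at depth `m`, where `t + d u ≤ 2 * m` turns into `t ≤ d u`.
  refine Bisim.of_family
    (R := fun t u v => (u = v ∧ t + d u ≤ 2 * m) ∨ (ty u v ∧ t ≤ d u ∧ t ≤ d v)) ?_
    (Or.inl ⟨rfl, by omega⟩)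
  have second : ∀ t u v, ty u v → t + 1 ≤ d u → t + 1 ≤ d v →
      ∃ e : G.neighborSet u ≃ H.neighborSet v, ∀ a : G.neighborSet u,
        ((a : V) = e a ∧ t + d a ≤ 2 * m) ∨ (ty a (e a) ∧ t ≤ d a ∧ t ≤ d (e a)) := by
    intro t u v huv hu hv
    obtain ⟨e, he⟩ := hty u v huv (by omega) (by omega)
    refine ⟨e, fun a => Or.inr ⟨he a, ?_, ?_⟩⟩
    · have := hdG a u (SimpleGraph.Adj.symm a.2)
      omega
    · have := hdH (e a) v (SimpleGraph.Adj.symm (e a).2)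
      omega
  rintro t u v (⟨rfl, h⟩ | ⟨huv, hu, hv⟩)
  · by_cases hu : d u < m
    · refine ⟨Equiv.setCongr (Set.ext fun v => hGH u v hu), fun a => Or.inl ⟨rfl, ?_⟩⟩
      have := hdG u a a.2
      omega
    · exact second t u u (hrefl u) (by have := hdm u; omega) (by have := hdm u; omega)
  · exact second t u v huv hu hv

/-- If `δ` grows by at most one along edges of `G`, and `ε` can be decreased by one until a vertex
that is recognized by its number of neighbors, then bisimilarity bounds `δ` by `ε`. -/
theorem Bisim.le_of_lipschitz {G : SimpleGraph V} {H : SimpleGraph W} {δ : V → ℕ} {ε : W → ℕ}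
    (hδ : ∀ u v, G.Adj u v → δ v ≤ δ u + 1)
    (hε : ∀ v k, ε v = k + 1 → ∃ w, H.Adj v w ∧ ε w = k)
    (h0 : ∀ u v, ε v = 0 → Bisim G H 1 u v → δ u = 0) {k t : ℕ} (hkt : k < t) {u : V} {v : W}
    (hv : ε v = k) (h : Bisim G H t u v) : δ u ≤ k := by
  induction k generalizing t u v with
  | zero => exact (h0 u v hv (h.mono hkt)).le
  | succ k ih =>
    obtain ⟨t, rfl⟩ : ∃ s, t = s + 1 := ⟨t - 1, by omega⟩
    obtain ⟨w, hw, hwk⟩ := hε v k hv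
    obtain ⟨e, he⟩ := h
    have h1 := he (e.symm ⟨w, hw⟩)
    rw [Equiv.apply_symm_apply] at h1
    have h2 := ih (by omega) hwk h1
    have h3 := hδ _ u (SimpleGraph.Adj.symm (e.symm ⟨w, hw⟩).2)
    omega

theorem Bisim.exists_of_reachable {G : SimpleGraph V} {H : SimpleGraph W} {x : V} {y : W}
    (h : ∀ t, Bisim G H t x y) {u : V} (hu : G.Reachable x u) (t : ℕ) :
    ∃ v, Bisim G H t u v := by
  have key : ∀ {a b : V} (_ : G.Walk a b), (∀ t, ∃ v, Bisim G H t a v) →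
      ∀ t, ∃ v, Bisim G H t b v := by
    intro a b w
    induction w with
    | nil => exact id
    | cons hadj _ ih =>
      refine fun h => ih fun t => ?_
      obtain ⟨v, e, he⟩ := h (t + 1)
      exact ⟨_, he ⟨_, hadj⟩⟩
  obtain ⟨w⟩ := hu
  exact key w (fun t => ⟨y, h t⟩) t

/-- Following a walk from `x` to `u` yields a partner `v` of `u` at depth `D + 1`. Descending along
`ε` from `v` then bounds `δ u` by `ε v ≤ D`. -/
theorem not_forall_bisim_of_lipschitz {G : SimpleGraph V} {H : SimpleGraph W} (hG : G.Connected)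
    {δ : V → ℕ} {ε : W → ℕ} (hδ : ∀ u v, G.Adj u v → δ v ≤ δ u + 1)
    (hε : ∀ v k, ε v = k + 1 → ∃ w, H.Adj v w ∧ ε w = k)
    (h0 : ∀ u v, ε v = 0 → Bisim G H 1 u v → δ u = 0) {D : ℕ} (hD : ∀ v, ε v ≤ D) {u : V}
    (hu : D < δ u) (x : V) (y : W) : ¬ ∀ t, Bisim G H t x y := by
  intro h
  obtain ⟨v, hv⟩ := Bisim.exists_of_reachable h (hG.preconnected x u) (D + 1)
  have := Bisim.le_of_lipschitz hδ hε h0 (Nat.lt_succ_of_le (hD v)) rfl hv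
  have := hD v
  omega

theorem exists_equiv_of_forall₂ {R : V → W → Prop} {A : Set V} {B : Set W} {l : List V}
    {m : List W} (hl : l.Nodup) (hm : m.Nodup) (hA : ∀ a, a ∈ A ↔ a ∈ l)
    (hB : ∀ b, b ∈ B ↔ b ∈ m) (h : List.Forall₂ R l m) :
    ∃ e : A ≃ B, ∀ a : A, R a (e a) := by
  classical
  have hlen := h.length_eq
  let e1 : A ≃ {a // a ∈ l} := Equiv.subtypeEquivRight hA
  let e2 : B ≃ {b // b ∈ m} := Equiv.subtypeEquivRight hB
  let f1 := hl.getEquiv l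
  let f2 := hm.getEquiv m
  refine ⟨((e1.trans f1.symm).trans (finCongr hlen)).trans (f2.trans e2.symm), fun a => ?_⟩
  have h1 := (List.forall₂_iff_get.1 h).2 (f1.symm (e1 a)) (f1.symm (e1 a)).2
    (hlen ▸ (f1.symm (e1 a)).2)
  have h2 : l.get (f1.symm (e1 a)) = a := congrArg Subtype.val (f1.apply_symm_apply (e1 a))
  rw [← h2]
  exact h1

end

/-! ### Lollipop graphs

Long paths `0, …, r` with `L` vertices each are arranged in a row. The last vertex of each of them
and the first vertex of the next one are opposite corners of a 4-cycle. The 4-cycle behind path `a`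
is opened to a 6-cycle, which also contains the last vertex of path `r`. -/

/-- The vertices of a lollipop graph: the vertices of the long paths, the connecting vertices
of degree two, and `p` leaves. -/
inductive LollipopVertex (r L p : ℕ) : Type
  | path (e : Fin (r + 1)) (i : Fin L) : LollipopVertex r L p
  | fst (e : Fin r) : LollipopVertex r L p
  | snd (e : Fin r) : LollipopVertex r L p
  | last : LollipopVertex r L p
  | leaf (j : Fin p) : LollipopVertex r L p

namespace LollipopVertex

variable {r L p : ℕ}

/-- The number of vertices of a lollipop graph is read off from this bijection. -/
def equivSum (r L p : ℕ) :
    LollipopVertex r L p ≃ (Fin (r + 1) × Fin L) ⊕ (Fin r ⊕ Fin r) ⊕ Unit ⊕ Fin p where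
  toFun
    | path e i => .inl (e, i)
    | fst e => .inr (.inl (.inl e))
    | snd e => .inr (.inl (.inr e))
    | last => .inr (.inr (.inl ()))
    | leaf j => .inr (.inr (.inr j))
  invFun
    | .inl (e, i) => path e i
    | .inr (.inl (.inl e)) => fst e
    | .inr (.inl (.inr e)) => snd e
    | .inr (.inr (.inl ())) => last
    | .inr (.inr (.inr j)) => leaf j
  left_inv v := by cases v <;> rfl
  right_inv v := by rcases v with _ | (_ | _) | _ | _ <;> rfl

/-- The edges of a lollipop graph, in one of their two directions. -/
def Arc (a : ℕ) : LollipopVertex r L p → LollipopVertex r L p → Prop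
  | path e i, path e' i' => e.val = e'.val ∧ i.val + 1 = i'.val
  | fst e, path e' i =>
    (e'.val = e.val ∧ i.val + 1 = L) ∨ (e'.val = e.val + 1 ∧ i.val = 0)
  | snd e, path e' i =>
    (e'.val = e.val ∧ i.val + 1 = L) ∨ (e.val = a ∧ e'.val = r ∧ i.val + 1 = L) ∨
      (e.val ≠ a ∧ e'.val = e.val + 1 ∧ i.val = 0)
  | last, path e' i => (e'.val = r ∧ i.val + 1 = L) ∨ (e'.val = a + 1 ∧ i.val = 0)
  | leaf _, path e i => e.val = 0 ∧ i.val = 0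
  | _, _ => False

/-- The position of a vertex within its long path, and `L` for the vertices outside. -/
def pos : LollipopVertex r L p → ℕ
  | path _ i => i.val
  | _ => L

/-- The first vertex of the first long path, and the leaves attached to it. -/
def IsOrigin : LollipopVertex r L p → Prop
  | path e i => e.val = 0 ∧ i.val = 0
  | leaf _ => True
  | _ => False

end LollipopVertex

open LollipopVertex

/-- The lollipop graph whose long path `r` leads back to the end of long path `a`. -/
def lollipop (r L p a : ℕ) : SimpleGraph (LollipopVertex r L p) where
  Adj u v := Arc a u v ∨ Arc a v u
  symm := ⟨fun _ _ h => h.symm⟩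
  loopless := ⟨fun u h => by cases u <;> simp [Arc] at h⟩

namespace lollipop

variable {r L p a : ℕ}

/-! ### Neighborhoods in lollipop graphs -/

theorem adj_iff (u v : LollipopVertex r L p) :
    (lollipop r L p a).Adj u v ↔ Arc a u v ∨ Arc a v u :=
  Iff.rfl

/-- This and the next two lemmas describe neighborhoods away from the origin by positions only. The
descriptions do not involve `a`, which is why opening a different 4-cycle is locally invisible. -/
theorem connector_neighbors (ha : a < r) (hL : 3 ≤ L) (u : LollipopVertex r L p)
    (hu : ¬ u.IsOrigin) (hp : u.pos = L) :
    ∃ w₁ w₂, w₁ ≠ w₂ ∧ (∀ w, (lollipop r L p a).Adj u w ↔ w = w₁ ∨ w = w₂) ∧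
      (w₁.pos = 0 ∨ w₁.pos + 1 = L) ∧ (w₂.pos = 0 ∨ w₂.pos + 1 = L) := by
  cases u with
  | path e i => exact absurd hp i.2.ne
  | leaf j => exact absurd trivial hu
  | fst e =>
    refine ⟨path ⟨e, by omega⟩ ⟨L - 1, by omega⟩, path ⟨e + 1, by omega⟩ ⟨0, by omega⟩, ?_, ?_,
      ?_, ?_⟩
    · simp
    · intro w
      cases w <;> simp [adj_iff, Arc, Fin.ext_iff, -Fin.val_eq_zero_iff] <;> omega
    · simp [pos]; omega
    · simp [pos]
  | snd e =>
    by_cases hea : e.val = a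
    · refine ⟨path ⟨e, by omega⟩ ⟨L - 1, by omega⟩, path ⟨r, by omega⟩ ⟨L - 1, by omega⟩,
        ?_, ?_, ?_, ?_⟩
      · simp; omega
      · intro w
        cases w <;> simp [adj_iff, Arc, Fin.ext_iff, -Fin.val_eq_zero_iff] <;> omega
      · simp [pos]; omega
      · simp [pos]; omega
    · refine ⟨path ⟨e, by omega⟩ ⟨L - 1, by omega⟩, path ⟨e + 1, by omega⟩ ⟨0, by omega⟩,
        ?_, ?_, ?_, ?_⟩
      · simp
      · intro w
        cases w <;> simp [adj_iff, Arc, Fin.ext_iff, -Fin.val_eq_zero_iff] <;> omega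
      · simp [pos]; omega
      · simp [pos]
  | last =>
    refine ⟨path ⟨r, by omega⟩ ⟨L - 1, by omega⟩, path ⟨a + 1, by omega⟩ ⟨0, by omega⟩, ?_, ?_,
      ?_, ?_⟩
    · simp; omega
    · intro w
      cases w <;> simp [adj_iff, Arc, Fin.ext_iff, -Fin.val_eq_zero_iff] <;> omega
    · simp [pos]; omega
    · simp [pos]

theorem port_neighbors (ha : a < r) (hL : 3 ≤ L) (u : LollipopVertex r L p)
    (hu : ¬ u.IsOrigin) (hp : u.pos = 0 ∨ u.pos + 1 = L) :
    ∃ w₁ w₂ w₃, w₁ ≠ w₂ ∧ w₁ ≠ w₃ ∧ w₂ ≠ w₃ ∧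
      (∀ w, (lollipop r L p a).Adj u w ↔ w = w₁ ∨ w = w₂ ∨ w = w₃) ∧
      (w₁.pos = 1 ∨ w₁.pos + 2 = L) ∧ w₂.pos = L ∧ w₃.pos = L := by
  cases u with
  | path e i =>
    simp only [pos, IsOrigin] at hu hp
    rcases hp with hi | hi
    · by_cases hea : e.val = a + 1
      · refine ⟨path e ⟨1, by omega⟩, fst ⟨e - 1, by omega⟩, last, ?_, ?_, ?_, ?_, ?_, ?_, ?_⟩
        · simp
        · simp
        · simp
        · intro w
          cases w <;> simp [adj_iff, Arc, Fin.ext_iff, -Fin.val_eq_zero_iff] <;> omega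
        · simp [pos]
        · simp [pos]
        · simp [pos]
      · refine ⟨path e ⟨1, by omega⟩, fst ⟨e - 1, by omega⟩, snd ⟨e - 1, by omega⟩,
          ?_, ?_, ?_, ?_, ?_, ?_, ?_⟩
        · simp
        · simp
        · simp
        · intro w
          cases w <;> simp [adj_iff, Arc, Fin.ext_iff, -Fin.val_eq_zero_iff] <;> omega
        · simp [pos]
        · simp [pos]
        · simp [pos]
    · by_cases her : e.val = r
      · refine ⟨path e ⟨L - 2, by omega⟩, last, snd ⟨a, by omega⟩, ?_, ?_, ?_, ?_, ?_, ?_, ?_⟩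
        · simp
        · simp
        · simp
        · intro w
          cases w <;> simp [adj_iff, Arc, Fin.ext_iff, -Fin.val_eq_zero_iff] <;> omega
        · simp [pos]; omega
        · simp [pos]
        · simp [pos]
      · refine ⟨path e ⟨L - 2, by omega⟩, fst ⟨e, by omega⟩, snd ⟨e, by omega⟩,
          ?_, ?_, ?_, ?_, ?_, ?_, ?_⟩
        · simp
        · simp
        · simp
        · intro w
          cases w <;> simp [adj_iff, Arc, Fin.ext_iff, -Fin.val_eq_zero_iff] <;> omega
        · simp [pos]; omega
        · simp [pos]
        · simp [pos]
  | leaf j => exact absurd trivial hu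
  | fst e => simp only [pos] at hp; omega
  | snd e => simp only [pos] at hp; omega
  | last => simp only [pos] at hp; omega

theorem inner_neighbors (u : LollipopVertex r L p) (h0 : 0 < u.pos) (h1 : u.pos + 1 < L) :
    ∃ w₁ w₂, w₁ ≠ w₂ ∧ (∀ w, (lollipop r L p a).Adj u w ↔ w = w₁ ∨ w = w₂) ∧
      w₁.pos + 1 = u.pos ∧ w₂.pos = u.pos + 1 := by
  cases u with
  | path e i =>
    simp only [pos] at h0 h1
    refine ⟨path e ⟨i - 1, by omega⟩, path e ⟨i + 1, by omega⟩, ?_, ?_, ?_, ?_⟩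
    · simp [Fin.ext_iff]
    · intro w
      cases w <;> simp [adj_iff, Arc, Fin.ext_iff, -Fin.val_eq_zero_iff] <;> omega
    · simp [pos]; omega
    · simp [pos]
  | leaf j => simp only [pos] at h1; omega
  | fst e => simp only [pos] at h1; omega
  | snd e => simp only [pos] at h1; omega
  | last => simp only [pos] at h1; omega

/-- The type of a vertex is its position up to the reversal `i ↦ L - 1 - i`. Reversal is needed
because a connector may join two last vertices, as `snd a` does. -/
theorem exists_equiv_neighborSet {b : ℕ} (ha : a < r) (hb : b < r) (hL : 3 ≤ L)
    {u v : LollipopVertex r L p} (hu : ¬ u.IsOrigin) (hv : ¬ v.IsOrigin)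
    (huv : u.pos = v.pos ∨ u.pos + v.pos + 1 = L) :
    ∃ e : (lollipop r L p a).neighborSet u ≃ (lollipop r L p b).neighborSet v,
      ∀ w : (lollipop r L p a).neighborSet u,
        (w : LollipopVertex r L p).pos = (e w : LollipopVertex r L p).pos ∨
          (w : LollipopVertex r L p).pos + (e w : LollipopVertex r L p).pos + 1 = L := by
  have hpos : ∀ w : LollipopVertex r L p, w.pos ≤ L := by
    intro w
    cases w <;> simp [pos]
  have hpu := hpos u
  have hpv := hpos v
  by_cases h1 : u.pos = L
  · obtain ⟨w₁, w₂, hne, hw, h3, h4⟩ := connector_neighbors ha hL u hu h1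
    obtain ⟨w₁', w₂', hne', hw', h3', h4'⟩ := connector_neighbors hb hL v hv (by omega)
    refine exists_equiv_of_forall₂ (A := (lollipop r L p a).neighborSet u)
      (B := (lollipop r L p b).neighborSet v)
      (R := fun w w' => w.pos = w'.pos ∨ w.pos + w'.pos + 1 = L)
      (l := [w₁, w₂]) (m := [w₁', w₂']) (by simp [hne]) (by simp [hne']) (by simp [hw])
      (by simp [hw']) ?_
    simp only [List.forall₂_cons, List.forall₂_nil_left_iff, and_true]
    omega
  by_cases h2 : u.pos = 0 ∨ u.pos + 1 = L
  · obtain ⟨w₁, w₂, w₃, n1, n2, n3, hw, h3, h4, h5⟩ := port_neighbors ha hL u hu h2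
    obtain ⟨w₁', w₂', w₃', n1', n2', n3', hw', h3', h4', h5'⟩ :=
      port_neighbors hb hL v hv (by omega)
    refine exists_equiv_of_forall₂ (A := (lollipop r L p a).neighborSet u)
      (B := (lollipop r L p b).neighborSet v)
      (R := fun w w' => w.pos = w'.pos ∨ w.pos + w'.pos + 1 = L)
      (l := [w₁, w₂, w₃]) (m := [w₁', w₂', w₃']) (by simp [n1, n2, n3])
      (by simp [n1', n2', n3']) (by simp [hw]) (by simp [hw']) ?_
    simp only [List.forall₂_cons, List.forall₂_nil_left_iff, and_true]
    omega
  obtain ⟨w₁, w₂, hne, hw, h3, h4⟩ := inner_neighbors (a := a) u (by omega) (by omega)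
  obtain ⟨w₁', w₂', hne', hw', h3', h4'⟩ := inner_neighbors (a := b) v (by omega) (by omega)
  rcases huv with huv | huv
  · refine exists_equiv_of_forall₂ (A := (lollipop r L p a).neighborSet u)
      (B := (lollipop r L p b).neighborSet v)
      (R := fun w w' => w.pos = w'.pos ∨ w.pos + w'.pos + 1 = L)
      (l := [w₁, w₂]) (m := [w₁', w₂']) (by simp [hne]) (by simp [hne']) (by simp [hw])
      (by simp [hw']) ?_
    simp only [List.forall₂_cons, List.forall₂_nil_left_iff, and_true]
    omega
  -- For reversed positions the lower neighbor corresponds to the upper one, so the second list is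
  -- swapped.
  · refine exists_equiv_of_forall₂ (A := (lollipop r L p a).neighborSet u)
      (B := (lollipop r L p b).neighborSet v)
      (R := fun w w' => w.pos = w'.pos ∨ w.pos + w'.pos + 1 = L)
      (l := [w₁, w₂]) (m := [w₂', w₁']) (by simp [hne]) (by simp [hne'.symm]) (by simp [hw])
      (by simp [hw', or_comm]) ?_
    simp only [List.forall₂_cons, List.forall₂_nil_left_iff, and_true]
    omega

/-- Vertices other than the leaves have at least two neighbors. -/
theorem exists_two_neighbors (ha : a < r) (hL : 3 ≤ L) (hp : 1 ≤ p) (u : LollipopVertex r L p)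
    (hu : ∀ j, u ≠ leaf j) :
    ∃ w₁ w₂, w₁ ≠ w₂ ∧ (lollipop r L p a).Adj u w₁ ∧ (lollipop r L p a).Adj u w₂ := by
  by_cases ho : u.IsOrigin
  · cases u with
    | path e i =>
      obtain ⟨he, hi⟩ := ho
      refine ⟨leaf ⟨0, hp⟩, path e ⟨1, by omega⟩, by simp, ?_, ?_⟩
      · simp [adj_iff, Arc, he, hi]
      · simp [adj_iff, Arc, hi]
    | leaf j => exact absurd rfl (hu j)
    | fst e => exact ho.elim
    | snd e => exact ho.elim
    | last => exact ho.elim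
  · by_cases h1 : u.pos = L
    · obtain ⟨w₁, w₂, hne, hw, -⟩ := connector_neighbors ha hL u ho h1
      exact ⟨w₁, w₂, hne, (hw _).2 (Or.inl rfl), (hw _).2 (Or.inr rfl)⟩
    by_cases h2 : u.pos = 0 ∨ u.pos + 1 = L
    · obtain ⟨w₁, w₂, w₃, hne, -, -, hw, -⟩ := port_neighbors ha hL u ho h2
      exact ⟨w₁, w₂, hne, (hw _).2 (Or.inl rfl), (hw _).2 (Or.inr (Or.inl rfl))⟩
    · have : u.pos ≤ L := by
        cases u <;> simp [pos]
      obtain ⟨w₁, w₂, hne, hw, -⟩ := inner_neighbors (a := a) u (by omega) (by omega)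
      exact ⟨w₁, w₂, hne, (hw _).2 (Or.inl rfl), (hw _).2 (Or.inr rfl)⟩

theorem connected (hL : 3 ≤ L) : (lollipop r L p a).Connected := by
  have hpath : ∀ (e : Fin (r + 1)) (i : ℕ) (hi : i < L),
      (lollipop r L p a).Reachable (path e ⟨0, by omega⟩) (path e ⟨i, hi⟩) := by
    intro e i
    induction i with
    | zero => exact fun _ => .refl _
    | succ i ih =>
      intro hi
      refine (ih (by omega)).trans (SimpleGraph.Adj.reachable ?_)
      simp [adj_iff, Arc]
  have hfst : ∀ e : Fin r, (lollipop r L p a).Reachable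
      (path ⟨e, by omega⟩ ⟨0, by omega⟩) (fst e) := by
    intro e
    refine (hpath _ (L - 1) (by omega)).trans (SimpleGraph.Adj.reachable ?_)
    simp [adj_iff, Arc]
    omega
  have hstart : ∀ (e : ℕ) (he : e < r + 1), (lollipop r L p a).Reachable
      (path ⟨0, by omega⟩ ⟨0, by omega⟩) (path ⟨e, he⟩ ⟨0, by omega⟩) := by
    intro e
    induction e with
    | zero => exact fun _ => .refl _
    | succ e ih =>
      intro he
      refine ((ih (by omega)).trans (hfst ⟨e, by omega⟩)).trans (SimpleGraph.Adj.reachable ?_)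
      simp [adj_iff, Arc]
  have hall : ∀ v, (lollipop r L p a).Reachable (path ⟨0, by omega⟩ ⟨0, by omega⟩) v := by
    intro v
    cases v with
    | path e i => exact (hstart e e.2).trans (hpath e i i.2)
    | fst e => exact (hstart e (by omega)).trans (hfst e)
    | snd e =>
      refine ((hstart e (by omega)).trans (hpath _ (L - 1) (by omega))).trans
        (SimpleGraph.Adj.reachable ?_)
      simp [adj_iff, Arc]
      omega
    | last =>
      refine ((hstart r (by omega)).trans (hpath _ (L - 1) (by omega))).trans
        (SimpleGraph.Adj.reachable ?_)
      simp [adj_iff, Arc]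
      omega
    | leaf j =>
      refine SimpleGraph.Adj.reachable ?_
      simp [adj_iff, Arc]
  have : Nonempty (LollipopVertex r L p) := ⟨last⟩
  exact ⟨fun u v => (hall u).symm.trans (hall v)⟩

/-! ### Depth and the agreement of the origins -/

theorem dist_le_succ_of_arc {a : ℕ} {δ : LollipopVertex r L p → ℕ}
    (h : ∀ u v, Arc a u v → δ u ≤ δ v + 1 ∧ δ v ≤ δ u + 1) (u v : LollipopVertex r L p)
    (huv : (lollipop r L p a).Adj u v) : δ v ≤ δ u + 1 :=
  huv.elim (fun h' => (h u v h').2) fun h' => (h v u h').1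

/-- The depth of a vertex in the initial part of a lollipop graph that ends with path `q`. -/
def depth (q : ℕ) : LollipopVertex r L p → ℕ
  | path e i => if e.val ≤ q then e.val * (L + 1) + i.val else q * (L + 1) + (L - 1)
  | fst e => if e.val < q then e.val * (L + 1) + L else q * (L + 1) + (L - 1)
  | snd e => if e.val < q then e.val * (L + 1) + L else q * (L + 1) + (L - 1)
  | last => q * (L + 1) + (L - 1)
  | leaf _ => 0

theorem depth_le (q : ℕ) (u : LollipopVertex r L p) : depth q u ≤ q * (L + 1) + (L - 1) := by
  have key : ∀ e < q, e * (L + 1) + (L + 1) ≤ q * (L + 1) := fun e he => by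
    rw [← Nat.succ_mul]
    exact Nat.mul_le_mul_right _ he
  cases u with
  | path e i =>
    simp only [depth]
    split_ifs with h
    · rcases h.lt_or_eq with h | h
      · have := key e h
        omega
      · rw [h]
        omega
    · omega
  | fst e =>
    simp only [depth]
    split_ifs with h
    · have := key e h
      omega
    · omega
  | snd e =>
    simp only [depth]
    split_ifs with h
    · have := key e h
      omega
    · omega
  | last => simp [depth]
  | leaf j => simp [depth]

theorem depth_arc {q : ℕ} (hqa : q ≤ a) (har : a < r) (u v : LollipopVertex r L p)
    (h : Arc a u v) : depth q u ≤ depth q v + 1 ∧ depth q v ≤ depth q u + 1 := by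
  cases u with
  | path e i =>
    cases v <;> simp only [Arc] at h
    simp only [depth, h.1]
    split_ifs <;> omega
  | fst e =>
    cases v <;> simp only [Arc] at h
    rcases h with ⟨h1, h2⟩ | ⟨h1, h2⟩ <;> simp only [depth, h1, Nat.succ_mul]
    · rcases lt_trichotomy e.val q with h | h | h
      · simp only [h, h.le, if_true]; omega
      · simp only [h, lt_irrefl, le_refl, if_true, if_false]; omega
      · simp only [h.not_gt, h.not_ge, if_false]; omega
    · by_cases h : e.val < q
      · simp only [h, Nat.succ_le_of_lt h, if_true]; omega
      · simp only [h, mt Nat.lt_of_succ_le h, if_false]; omega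
  | snd e =>
    cases v <;> simp only [Arc] at h
    rcases h with ⟨h1, h2⟩ | ⟨h0, h1, h2⟩ | ⟨h0, h1, h2⟩ <;> simp only [depth, h1, Nat.succ_mul]
    · rcases lt_trichotomy e.val q with h | h | h
      · simp only [h, h.le, if_true]; omega
      · simp only [h, lt_irrefl, le_refl, if_true, if_false]; omega
      · simp only [h.not_gt, h.not_ge, if_false]; omega
    · rw [if_neg (by omega), if_neg (by omega)]; omega
    · by_cases h : e.val < q
      · simp only [h, Nat.succ_le_of_lt h, if_true]; omega
      · simp only [h, mt Nat.lt_of_succ_le h, if_false]; omega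
  | last =>
    cases v <;> simp only [Arc] at h
    simp only [depth]
    rw [if_neg (by omega)]
    omega
  | leaf j =>
    cases v <;> simp only [Arc] at h
    simp [depth, h.1, h.2, -Fin.val_eq_zero_iff]

/-- Edges that depend on the parameter join a connector behind path `q` to a vertex no earlier than
the end of path `q`, so both ends have the maximal depth. -/
theorem arc_iff_of_depth_lt {q b : ℕ} (hqa : q ≤ a) (har : a < r) (hqb : q ≤ b) (hbr : b < r)
    (u v : LollipopVertex r L p)
    (h : depth q u < q * (L + 1) + (L - 1) ∨ depth q v < q * (L + 1) + (L - 1)) :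
    Arc a u v ↔ Arc b u v := by
  have hle : ∀ (e : Fin (r + 1)) (i : Fin L),
      depth q (path e i : LollipopVertex r L p) < q * (L + 1) + (L - 1) → e.val ≤ q := by
    intro e i h
    by_contra hc
    simp [depth, hc] at h
  have hlt : ∀ (e : Fin r),
      depth q (snd e : LollipopVertex r L p) < q * (L + 1) + (L - 1) → e.val < q := by
    intro e h
    by_contra hc
    simp [depth, hc] at h
  cases u <;> cases v <;> simp only [Arc]
  case snd.path e e' i =>
    rcases h with h | h
    · have := hlt _ h
      omega
    · have := hle _ _ h
      omega
  case last.path e i =>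
    rcases h with h | h
    · simp [depth] at h
    · have := hle _ _ h
      omega

theorem bisim_origin {q b : ℕ} (hqa : q ≤ a) (har : a < r) (hqb : q ≤ b) (hbr : b < r)
    (hL : 3 ≤ L) {x : LollipopVertex r L p} (hx : x.IsOrigin) :
    Bisim (lollipop r L p a) (lollipop r L p b) (2 * (q * (L + 1) + (L - 1))) x x := by
  have horigin : ∀ u : LollipopVertex r L p, u.IsOrigin → depth q u = 0 := by
    intro u hu
    cases u with
    | path e i => simp [depth, hu.1, hu.2, -Fin.val_eq_zero_iff]
    | leaf j => rfl
    | fst e => exact hu.elim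
    | snd e => exact hu.elim
    | last => exact hu.elim
  refine bisim_two_mul_of_homogeneous _ (depth q) (fun u v => u.pos = v.pos ∨ u.pos + v.pos + 1 = L)
    (fun u => Or.inl rfl) (depth_le q) (dist_le_succ_of_arc (depth_arc hqa har))
    (dist_le_succ_of_arc (depth_arc hqb hbr)) ?_ ?_ (horigin x hx)
  · intro u v h
    rw [adj_iff, adj_iff, arc_iff_of_depth_lt hqa har hqb hbr u v (Or.inl h),
      arc_iff_of_depth_lt hqa har hqb hbr v u (Or.inr h)]
  · intro u v huv hu hv
    exact exists_equiv_neighborSet har hbr hL (fun h => by have := horigin u h; omega)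
      (fun h => by have := horigin v h; omega) huv

/-! ### Distance from the leaves -/

/-- A lower bound for the distance of a vertex from the leaves, increased by one for vertices other
than leaves, when path `k + 2` leads back to its own beginning. -/
def lowerDist (k : ℕ) : LollipopVertex r L p → ℕ
  | path e i => if e.val ≤ k + 1 then e.val * (L + 1) + i.val + 1 else (k + 2) * (L + 1) + 1
  | fst e => e.val * (L + 1) + L + 1
  | snd e => e.val * (L + 1) + L + 1
  | last => (k + 1) * (L + 1) + L + 1
  | leaf _ => 0

/-- The distance of a vertex from the leaves when path `k + 2` leads back to the end of
path `k`. -/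
def upperDist (k : ℕ) : LollipopVertex r L p → ℕ
  | path e i => if e.val ≤ k + 1 then e.val * (L + 1) + i.val + 1 else (k + 1) * (L + 1) + L - i.val
  | fst e => e.val * (L + 1) + L + 1
  | snd e => e.val * (L + 1) + L + 1
  | last => (k + 1) * (L + 1) + 2
  | leaf _ => 0

theorem lowerDist_arc {k : ℕ} (u v : LollipopVertex (k + 2) L p) (h : Arc (k + 1) u v) :
    lowerDist k u ≤ lowerDist k v + 1 ∧ lowerDist k v ≤ lowerDist k u + 1 := by
  have hk : (k + 2) * (L + 1) = (k + 1) * (L + 1) + L + 1 := by ring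
  cases u with
  | path e i =>
    cases v <;> simp only [Arc] at h
    simp only [lowerDist, h.1]
    split_ifs <;> omega
  | fst e =>
    cases v <;> simp only [Arc] at h
    rcases h with ⟨h1, h2⟩ | ⟨h1, h2⟩ <;> simp only [lowerDist, h1]
    · rw [if_pos (by omega)]; omega
    · have he : (e.val + 1) * (L + 1) = e.val * (L + 1) + L + 1 := by ring
      by_cases h : e.val = k + 1
      · rw [if_neg (by omega), h]; omega
      · rw [if_pos (by omega)]; omega
  | snd e =>
    cases v <;> simp only [Arc] at h
    rcases h with ⟨h1, h2⟩ | ⟨h0, h1, h2⟩ | ⟨h0, h1, h2⟩ <;> simp only [lowerDist, h1]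
    · rw [if_pos (by omega)]; omega
    · rw [if_neg (by omega), h0]; omega
    · have he : (e.val + 1) * (L + 1) = e.val * (L + 1) + L + 1 := by ring
      rw [if_pos (by omega)]; omega
  | last =>
    cases v <;> simp only [Arc] at h
    simp only [lowerDist]
    rw [if_neg (by omega)]
    omega
  | leaf j =>
    cases v <;> simp only [Arc] at h
    simp [lowerDist, h.1, h.2, -Fin.val_eq_zero_iff]

theorem upperDist_le {k : ℕ} (hL : 3 ≤ L) (u : LollipopVertex (k + 2) L p) :
    upperDist k u ≤ (k + 2) * (L + 1) := by
  have hk : (k + 2) * (L + 1) = (k + 1) * (L + 1) + L + 1 := by ring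
  have key : ∀ e ≤ k + 1, e * (L + 1) ≤ (k + 1) * (L + 1) := fun e he => Nat.mul_le_mul_right _ he
  cases u with
  | path e i =>
    simp only [upperDist]
    split_ifs with h
    · have := key e h
      omega
    · omega
  | fst e =>
    have := key e (by omega)
    simp only [upperDist]
    omega
  | snd e =>
    have := key e (by omega)
    simp only [upperDist]
    omega
  | last => simp only [upperDist]; omega
  | leaf j => simp [upperDist]

theorem exists_adj_upperDist {k : ℕ} (hL : 3 ≤ L) (hp : 1 ≤ p) (v : LollipopVertex (k + 2) L p)
    (n : ℕ) (hv : upperDist k v = n + 1) :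
    ∃ w, (lollipop (k + 2) L p k).Adj v w ∧ upperDist k w = n := by
  cases v with
  | path e i =>
    simp only [upperDist] at hv
    by_cases he : e.val ≤ k + 1
    · rw [if_pos he] at hv
      by_cases hi : i.val = 0
      · by_cases he0 : e.val = 0
        · refine ⟨leaf ⟨0, hp⟩, ?_, ?_⟩
          · simp [adj_iff, Arc, he0, hi]
          · rw [he0, hi] at hv
            simp only [upperDist]
            omega
        · refine ⟨fst ⟨e - 1, by omega⟩, ?_, ?_⟩
          · simp [adj_iff, Arc, hi]; omega
          · obtain ⟨e', he'⟩ : ∃ e', e.val = e' + 1 := ⟨e - 1, by omega⟩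
            simp only [upperDist, he', Nat.add_sub_cancel]
            rw [he', Nat.succ_mul] at hv
            omega
      · refine ⟨path e ⟨i - 1, by omega⟩, ?_, ?_⟩
        · simp [adj_iff, Arc]; omega
        · simp only [upperDist, if_pos he]
          omega
    · rw [if_neg he] at hv
      -- Path `k + 2` is traversed in the direction of increasing positions: its last vertex is the
      -- one next to `snd k`, through which the leaves are reached.
      by_cases hi : i.val + 1 = L
      · refine ⟨snd ⟨k, by omega⟩, ?_, ?_⟩
        · simp [adj_iff, Arc]; omega
        · simp only [upperDist]
          rw [Nat.succ_mul] at hv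
          omega
      · refine ⟨path e ⟨i + 1, by omega⟩, ?_, ?_⟩
        · simp [adj_iff, Arc]
        · simp only [upperDist, if_neg he]
          omega
  | fst e =>
    simp only [upperDist] at hv
    refine ⟨path ⟨e, by omega⟩ ⟨L - 1, by omega⟩, ?_, ?_⟩
    · simp [adj_iff, Arc]; omega
    · simp only [upperDist]
      rw [if_pos (by omega)]
      omega
  | snd e =>
    simp only [upperDist] at hv
    refine ⟨path ⟨e, by omega⟩ ⟨L - 1, by omega⟩, ?_, ?_⟩
    · simp [adj_iff, Arc]; omega
    · simp only [upperDist]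
      rw [if_pos (by omega)]
      omega
  | last =>
    simp only [upperDist] at hv
    refine ⟨path ⟨k + 2, by omega⟩ ⟨L - 1, by omega⟩, ?_, ?_⟩
    · simp [adj_iff, Arc]; omega
    · simp only [upperDist]
      rw [if_neg (by omega)]
      omega
  | leaf j => simp [upperDist] at hv

/-- With a loop of one path, the first vertex of path `k + 2` is at distance at least `(k + 2) * (L
+ 1) + 1` from the leaves. With a loop of two paths, which can be entered from both sides, no
distance exceeds `(k + 2) * (L + 1)`. -/
theorem not_forall_bisim {k : ℕ} (hL : 3 ≤ L) (hp : 1 ≤ p) (x y : LollipopVertex (k + 2) L p) :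
    ¬ ∀ t, Bisim (lollipop (k + 2) L p (k + 1)) (lollipop (k + 2) L p k) t x y := by
  refine not_forall_bisim_of_lipschitz (connected hL) (dist_le_succ_of_arc lowerDist_arc)
    (exists_adj_upperDist hL hp) ?_ (upperDist_le hL)
    (u := path ⟨k + 2, by omega⟩ ⟨0, by omega⟩) ?_ x y
  -- One round compares degrees: `upperDist` vanishes only at leaves, which have a single neighbor,
  -- while all other vertices have at least two.
  · rintro u v hv ⟨e, -⟩
    by_cases hu : ∃ j, u = leaf j
    · obtain ⟨j, rfl⟩ := hu
      rfl
    push Not at hu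
    obtain ⟨w₁, w₂, hne, h1, h2⟩ := exists_two_neighbors (a := k + 1) (by omega) hL hp u hu
    have hsub : ∀ w w', (lollipop (k + 2) L p k).Adj v w → (lollipop (k + 2) L p k).Adj v w' →
        w = w' := by
      cases v with
      | leaf j =>
        intro w w' hw hw'
        cases w <;> simp only [adj_iff, Arc, or_false] at hw
        cases w' <;> simp only [adj_iff, Arc, or_false] at hw'
        simp [Fin.ext_iff, -Fin.val_eq_zero_iff, hw, hw']
      | path e i =>
        simp only [upperDist] at hv
        split_ifs at hv
        omega
      | fst e => simp [upperDist] at hv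
      | snd e => simp [upperDist] at hv
      | last => simp [upperDist] at hv
    have := e.injective (Subtype.ext (hsub _ _ (e ⟨w₁, h1⟩).2 (e ⟨w₂, h2⟩).2))
    exact absurd (congrArg Subtype.val this) hne
  · simp [lowerDist]

theorem card_eq (r L p : ℕ) : Nat.card (LollipopVertex r L p) = (r + 1) * L + 2 * r + 1 + p := by
  rw [Nat.card_congr (equivSum r L p)]
  simp [Nat.card_eq_fintype_card]
  ring

end lollipop

/-! ### The lower bound -/

theorem Bisim.iso_iff {V W X Y : Type*} {G : SimpleGraph V} {H : SimpleGraph W}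
    {G' : SimpleGraph X} {H' : SimpleGraph Y} (e : G ≃g G') (f : H ≃g H') (t : ℕ) (u : V) (v : W) :
    Bisim G' H' t (e u) (f v) ↔ Bisim G H t u v :=
  ⟨fun h => ((of_iso e t u).trans h).trans (of_iso f t v).symm,
    fun h => ((of_iso e t u).symm.trans h).trans (of_iso f t v)⟩

/-- Parameters of lollipop graphs with `n` vertices and almost `n` vertices before the loop. -/
theorem exists_lollipop_parameters {n : ℕ} (hn : 64 ≤ n) :
    ∃ k L p : ℕ, 3 ≤ L ∧ 1 ≤ p ∧ (k + 2 + 1) * L + 2 * (k + 2) + 1 + p = n ∧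
      n ≤ k * (L + 1) + (L - 1) + 8 * Nat.sqrt n := by
  obtain ⟨s, hs⟩ : ∃ s, s = Nat.sqrt n := ⟨_, rfl⟩
  have h8 : 8 ≤ s := by
    rw [hs, Nat.le_sqrt]
    omega
  have h1 : s * s ≤ n := hs ▸ Nat.sqrt_le n
  have h2 : n < (s + 1) * (s + 1) := hs ▸ Nat.lt_succ_sqrt n
  obtain ⟨c, hc⟩ : ∃ c, c = n / (s + 2) := ⟨_, rfl⟩
  have h3 : 3 ≤ c := by
    rw [hc, Nat.le_div_iff_mul_le (by omega)]
    nlinarith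
  have h4 : c ≤ s := by
    rw [hc, ← Nat.lt_succ_iff, Nat.div_lt_iff_lt_mul (by omega)]
    nlinarith
  have h5 : (s + 2) * c + n % (s + 2) = n := hc ▸ Nat.div_add_mod n (s + 2)
  have h6 : n % (s + 2) < s + 2 := Nat.mod_lt _ (by omega)
  obtain ⟨k, rfl⟩ : ∃ k, c = k + 3 := ⟨c - 3, by omega⟩
  -- The `k + 3` paths with their connectors account for `(k + 3) * (s + 2) - 1` vertices, so the
  -- leaves take up the remainder of the division plus one. The deficit is then at most `k + 3 * s +
  -- 8`, and `k + 3 ≤ s`.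
  refine ⟨k, s, n % (s + 2) + 1, by omega, by omega, ?_, ?_⟩
  · linarith [h5]
  · rw [← hs]
    have h7 : (s + 2) * (k + 3) = k * (s + 1) + k + 3 * s + 6 := by ring
    omega

theorem exists_bisim_not_bisim_of_large {n : ℕ} (hn : 64 ≤ n) :
    ∃ G H : SimpleGraph (Fin n), G.Connected ∧ H.Connected ∧ ∃ g h : Fin n,
      (∀ i : ℕ, (i : ℝ) ≤ 2 * (n : ℝ) - 16 * Real.sqrt (n : ℝ) → Bisim G H i g h) ∧
      ¬ ∀ t, Bisim G H t g h := by
  obtain ⟨k, L, p, hL, hp, hcard, hbound⟩ := exists_lollipop_parameters hn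
  have : Finite (LollipopVertex (k + 2) L p) :=
    Finite.of_equiv _ (LollipopVertex.equivSum (k + 2) L p).symm
  let e : Fin n ≃ LollipopVertex (k + 2) L p :=
    (Finite.equivFinOfCardEq ((lollipop.card_eq (k + 2) L p).trans hcard)).symm
  let eG := SimpleGraph.Iso.comap e (lollipop (k + 2) L p (k + 1))
  let eH := SimpleGraph.Iso.comap e (lollipop (k + 2) L p k)
  let x : LollipopVertex (k + 2) L p := .leaf ⟨0, hp⟩
  refine ⟨_, _, eG.connected_iff.2 (lollipop.connected hL),
    eH.connected_iff.2 (lollipop.connected hL), e.symm x, e.symm x, fun i hi => ?_, fun h => ?_⟩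
  · rw [← Bisim.iso_iff eG eH]
    have h1 : eG (e.symm x) = x := e.apply_symm_apply x
    have h2 : eH (e.symm x) = x := e.apply_symm_apply x
    rw [h1, h2]
    refine (lollipop.bisim_origin (q := k) (by omega) (by omega) le_rfl (by omega) hL
      (x := x) trivial).mono ?_
    have h3 : ((Nat.sqrt n : ℕ) : ℝ) ≤ Real.sqrt n := Real.nat_sqrt_le_real_sqrt
    have h4 : (i : ℝ) + 16 * (Nat.sqrt n : ℕ) ≤ 2 * n := by linarith
    have h5 : i + 16 * Nat.sqrt n ≤ 2 * n := by exact_mod_cast h4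
    omega
  · exact lollipop.not_forall_bisim hL hp _ _ fun t => (Bisim.iso_iff eG eH t _ _).2 (h t)

/-- The complete graph and a star differ already in degrees. This covers the small `n`, for which no
truncation has to agree. -/
theorem exists_not_bisim {n : ℕ} (hn : 3 ≤ n) :
    ∃ G H : SimpleGraph (Fin n), G.Connected ∧ H.Connected ∧ ∃ g h : Fin n,
      ¬ Bisim G H 1 g h := by
  let c : Fin n := ⟨0, by omega⟩
  let H : SimpleGraph (Fin n) := SimpleGraph.fromRel fun u _ => u = c
  have hne : Nonempty (Fin n) := ⟨c⟩
  have hH : ∀ v, H.Reachable c v := by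
    intro v
    by_cases hv : c = v
    · rw [hv]
    · exact SimpleGraph.Adj.reachable (by simp [H, hv])
  refine ⟨⊤, H, SimpleGraph.connected_top, ⟨fun u v => (hH u).symm.trans (hH v)⟩, c,
    ⟨1, by omega⟩, ?_⟩
  rintro ⟨e, -⟩
  have hsub : ∀ w, H.Adj ⟨1, by omega⟩ w → w = c := by
    intro w hw
    simpa [H, c] using hw.2
  have h1 : (⊤ : SimpleGraph (Fin n)).Adj c ⟨1, by omega⟩ := by simp [c]
  have h2 : (⊤ : SimpleGraph (Fin n)).Adj c ⟨2, by omega⟩ := by simp [c]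
  have := e.injective (Subtype.ext ((hsub _ (e ⟨_, h1⟩).2).trans (hsub _ (e ⟨_, h2⟩).2).symm))
  exact absurd (congrArg (fun z => z.1.1) this) (by simp)

theorem exists_bisim_not_bisim {n : ℕ} (hn : 3 ≤ n) :
    ∃ G H : SimpleGraph (Fin n), G.Connected ∧ H.Connected ∧ ∃ g h : Fin n,
      (∀ i : ℕ, (i : ℝ) ≤ 2 * (n : ℝ) - 16 * Real.sqrt (n : ℝ) → Bisim G H i g h) ∧
      ¬ ∀ t, Bisim G H t g h := by
  by_cases h64 : 64 ≤ n
  · exact exists_bisim_not_bisim_of_large h64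
  · obtain ⟨G, H, hG, hH, g, h, hgh⟩ := exists_not_bisim hn
    refine ⟨G, H, hG, hH, g, h, fun i hi => ?_, fun hall => hgh (hall 1)⟩
    -- For `n < 64` the bound `2n - 16√n = 2√n(√n - 8)` is negative, so no `i` qualifies.
    exfalso
    have h0 : (0 : ℝ) < n := by exact_mod_cast (by omega : 0 < n)
    have h1 : (n : ℝ) < 8 ^ 2 := by exact_mod_cast (by omega : n < 8 ^ 2)
    have h2 : Real.sqrt n < 8 := (Real.sqrt_lt' (by norm_num)).2 h1
    have h3 : 0 < Real.sqrt n := Real.sqrt_pos.2 h0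
    have h4 : Real.sqrt n * Real.sqrt n = n := Real.mul_self_sqrt h0.le
    have h5 : (0 : ℝ) ≤ i := Nat.cast_nonneg i
    nlinarith

theorem lt_of_depthSuffices {n t : ℕ} (hn : 3 ≤ n) (ht : DepthSuffices n t) :
    2 * (n : ℝ) - 16 * Real.sqrt (n : ℝ) < (t : ℝ) := by
  by_contra! hle
  obtain ⟨G, H, hG, hH, g, h, h1, h2⟩ := exists_bisim_not_bisim hn
  have h3 := ht (Fin n) (Fin n) G H hG hH (by simp) (by simp) g h
    (truncIso_unfolding_of_bisim (h1 t hle))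
  exact h2 fun s => bisim_of_bisim_unfolding (Bisim.of_rootedIso h3 s)

theorem tendsto_div_of_bounds {T : ℕ → ℕ} (hlt : ∀ n, 1 ≤ n → T n < 2 * n)
    (hgt : ∀ n : ℕ, 3 ≤ n → 2 * (n : ℝ) - 16 * Real.sqrt (n : ℝ) < (T n : ℝ)) :
    Tendsto (fun n : ℕ => (T n : ℝ) / (n : ℝ)) atTop (𝓝 2) := by
  have hs : Tendsto (fun n : ℕ => 2 - 16 * (Real.sqrt (n : ℝ))⁻¹) atTop (𝓝 2) := by
    have h1 : Tendsto (fun n : ℕ => (Real.sqrt (n : ℝ))⁻¹) atTop (𝓝 0) :=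
      tendsto_inv_atTop_zero.comp (Real.tendsto_sqrt_atTop.comp tendsto_natCast_atTop_atTop)
    simpa using (h1.const_mul 16).const_sub 2
  refine tendsto_of_tendsto_of_tendsto_of_le_of_le' hs tendsto_const_nhds ?_ ?_
  · filter_upwards [eventually_ge_atTop 3] with n hn
    have h0 : (0 : ℝ) < n := by exact_mod_cast (by omega : 0 < n)
    have h3 : 0 < Real.sqrt n := Real.sqrt_pos.2 h0
    have h4 : Real.sqrt n * Real.sqrt n = n := Real.mul_self_sqrt h0.le
    rw [le_div_iff₀ h0]
    have h5 : (2 - 16 * (Real.sqrt (n : ℝ))⁻¹) * n = 2 * n - 16 * Real.sqrt n := by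
      nth_rewrite 2 [← h4]
      field_simp
      linear_combination 2 * h4
    rw [h5]
    exact (hgt n hn).le
  · filter_upwards [eventually_ge_atTop 1] with n hn
    have h0 : (0 : ℝ) < n := by exact_mod_cast hn
    rw [div_le_iff₀ h0]
    exact_mod_cast (hlt n hn).le

/-! ### The main theorem -/

theorem mainTheorem1 :
    (∀ n : ℕ, 3 ≤ n →
      ∃ G H : SimpleGraph (Fin n), G.Connected ∧ H.Connected ∧
        ∀ (VU VW : Type) (U : SimpleGraph VU) (W : SimpleGraph VW),
          IsUniversalCover U G → IsUniversalCover W H →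
          ∃ (x : VU) (y : VW),
            (∀ i : ℕ, (i : ℝ) ≤ 2 * (n : ℝ) - 16 * Real.sqrt (n : ℝ) → TruncIso i U x W y) ∧
            ¬ RootedIso U x W y) ∧
    ∃ T : ℕ → ℕ,
      (∀ n : ℕ, IsLeast {t : ℕ | DepthSuffices n t} (T n)) ∧
      (∀ n : ℕ, 1 ≤ n → T n < 2 * n) ∧
      (∀ n : ℕ, 3 ≤ n → 2 * (n : ℝ) - 16 * Real.sqrt (n : ℝ) < (T n : ℝ)) ∧
      (∃ n : ℕ, n < T n) ∧
      Tendsto (fun n : ℕ => (T n : ℝ) / (n : ℝ)) atTop (𝓝 2) := by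
  classical
  refine ⟨fun n hn => ?_, ?_⟩
  · obtain ⟨G, H, hG, hH, g, h, h1, h2⟩ := exists_bisim_not_bisim hn
    refine ⟨G, H, hG, hH, fun VU VW U W hU hW => ?_⟩
    obtain ⟨x, y, h3, h4⟩ := exists_truncIso_universalCover hG hH h2 hU hW
    exact ⟨x, y, fun i hi => h3 i (h1 i hi), h4⟩
  · have hex : ∀ n, ∃ t, DepthSuffices n t := fun n => ⟨_, depthSuffices_two_mul_sub_one n⟩
    have hgt : ∀ n : ℕ, 3 ≤ n →
        2 * (n : ℝ) - 16 * Real.sqrt (n : ℝ) < ((Nat.find (hex n) : ℕ) : ℝ) :=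
      fun n hn => lt_of_depthSuffices hn (Nat.find_spec (hex n))
    have hlt : ∀ n, 1 ≤ n → Nat.find (hex n) < 2 * n := fun n hn => by
      have := Nat.find_min' (hex n) (depthSuffices_two_mul_sub_one n)
      omega
    refine ⟨fun n => Nat.find (hex n),
      fun n => ⟨Nat.find_spec (hex n), fun t ht => Nat.find_min' (hex n) ht⟩, hlt, hgt,
      -- The lower bound exceeds `n` once `√n > 16`; for the square `400` it equals `800 - 320 =
      -- 480`.
      ⟨400, ?_⟩, tendsto_div_of_bounds hlt hgt⟩
    have h1 := hgt 400 (by norm_num)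
    have h2 : Real.sqrt ((400 : ℕ) : ℝ) = 20 := by
      rw [show ((400 : ℕ) : ℝ) = 20 ^ 2 by norm_num]
      exact Real.sqrt_sq (by norm_num)
    rw [h2] at h1
    have h3 : ((400 : ℕ) : ℝ) < ((Nat.find (hex 400) : ℕ) : ℝ) := by
      refine lt_trans ?_ h1
      norm_num
    exact_mod_cast h3
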